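/- \textbf{Setting.} Let $(K,d)$ be a metric space in which sets of finite diameter are relatively compact, and let $V$ and $E$ be the finite sets of vertices and edges of a directed multigraph, where the edge $e$ has initial vertex $i(e)$ and terminal vertex $t(e)$. Let $(K_v)_{v\in V}$ be a partition of $K$ into non-empty open sets. For each $e\in E$ let $w_e:K\to K$ be a Borel map with $w_e(K_{i(e)})\subset K_{t(e)}$, and let $p_e:K\to[0,\infty)$ be a Borel function that vanishes off $K_{i(e)}$, such that $\sum_{e\in E}p_e(x)=1$ for all $x\in K$. Assume that the system is contractive on average: there is $0<a<1$ with $\sum_{e\in E}p_e(x)\,d(w_ex,w_ey)\le a\,d(x,y)$ for all $v\in V$ and $x,y\in K_v$. Assume also that each $p_e|_{K_{i(e)}}$ is uniformly continuous and that there is $\delta>0$ with $p_e|_{K_{i(e)}}\ge\delta$ for all $e\in E$. Such a system is called a contractive Markov system (CMS). A Borel probability measure $\mu$ on $K$ is \emph{invariant} if $\int\sum_{e}p_e\cdot(f\circ w_e)\,d\mu=\int f\,d\mu$ for all bounded Borel functions $f:K\to\mathbb R$. Let $\Sigma=E^{\mathbb Z}$ with the product topology and its Borel $\sigma$-algebra,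 and let $S$ be the left shift on $\Sigma$, $(S\sigma)_n=\sigma_{n+1}$. The generalized Markov measure $M$ associated with an invariant measure $\mu$ is the Borel probability measure on $\Sigma$ with $$M(\{\sigma:\sigma_m=e_1,\dots,\sigma_{m+k-1}=e_k\})=\int p_{e_1}(x)\,p_{e_2}(w_{e_1}x)\cdots p_{e_k}(w_{e_{k-1}}\circ\cdots\circ w_{e_1}x)\,d\mu(x)$$ for all $m\in\mathbb Z$ and $e_1,\dots,e_k\in E$. Fix $x_v\in K_v$ for each $v\in V$. Let $D$ be the set of all $\sigma\in\Sigma$ with $t(\sigma_j)=i(\sigma_{j+1})$ for all $j\in\mathbb Z$ for which the limit $$F(\sigma)=\lim_{m\to-\infty}w_{\sigma_0}\circ w_{\sigma_{-1}}\circ\cdots\circ w_{\sigma_m}(x_{i(\sigma_m)})$$ exists in $K$, and let $Y=\bigcap_{j\in\mathbb Z}S^j(D)$. Define $u:\Sigma\to[-\infty,0]$ by $u(\sigma)=\log p_{\sigma_1}(F(\sigma))$ for $\sigma\in Y$ and $u(\sigma)=-\infty$ for $\sigma\notin Y$. For an $S$-invariant Borel probability measure $\Theta$ on $\Sigma$ let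 $h_\Theta(S)$ be the Kolmogorov--Sinai entropy of $S$ with respect to $\Theta$, and put $\Theta(u)=\int u\,d\Theta\in[-\infty,0]$. An \emph{equilibrium state} for $u$ is an $S$-invariant Borel probability measure $\Lambda$ on $\Sigma$ with $h_\Lambda(S)+\Lambda(u)=\sup_\Theta\bigl(h_\Theta(S)+\Theta(u)\bigr)$, where the supremum is over all $S$-invariant Borel probability measures $\Theta$ on $\Sigma$. \textbf{Theorem.} Suppose that the CMS has a unique invariant Borel probability measure $\mu$, and that $M(Y)=1$ for the associated generalized Markov measure $M$. Then $u$ is Borel measurable and the following hold. (i) $M$ is the unique equilibrium state for $u$. (ii) $F(M)=\mu$, i.e. $\mu$ is the image of $M$ under $F$ (which is defined $M$-almost everywhere). (iii) $h_M(S)=-\sum_{e\in E}\int_{K_{i(e)}}p_e\log p_e\,d\mu$. -/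

import Mathlib

open MeasureTheory Filter Topology
open scoped ENNReal

noncomputable section

/-! ## Entropy, pressure and equilibrium states -/

section Thermodynamics

variable {X : Type*} [MeasurableSpace X]

/-- The Shannon entropy `-∑ j, Θ(ξ = j) log Θ(ξ = j)` of the finite partition `{ξ = j}`. -/
def partitionEntropy {ι : Type*} [Fintype ι] (Θ : Measure X) (ξ : X → ι) : ℝ :=
  ∑ j, Real.negMulLog (Θ.real (ξ ⁻¹' {j}))

/-- The labelling map of the join of the partitions `ξ, T⁻¹ ξ, …, T⁻⁽ⁿ⁻¹⁾ ξ`. -/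
def itinerary {ι : Type*} (T : X → X) (ξ : X → ι) (n : ℕ) (x : X) : Fin n → ι :=
  fun j => ξ (T^[j] x)

/-- The Kolmogorov-Sinai entropy: the supremum over all finite measurable partitions `ξ` of the
limit of `H(ξ ∨ T⁻¹ ξ ∨ … ∨ T⁻⁽ⁿ⁻¹⁾ ξ) / n`. For an invariant probability measure this limit exists
by subadditivity, so that it is the upper limit. -/
def ksEntropy (Θ : Measure X) (T : X → X) : EReal :=
  ⨆ (k : ℕ) (ξ : X → Fin k) (_ : Measurable ξ),
    limsup (fun n : ℕ => ((partitionEntropy Θ (itinerary T ξ n) / n : ℝ) : EReal)) atTop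

/-- An energy function is a measurable function with values in `[-∞, 0]`. -/
def IsEnergyFunction (f : X → EReal) : Prop :=
  Measurable f ∧ ∀ x, f x ≤ 0

/-- The integral `Θ(f) ∈ [-∞, 0]` of an energy function `f`. -/
def energyIntegral (Θ : Measure X) (f : X → EReal) : EReal :=
  -((∫⁻ x, (-f x).toENNReal ∂Θ : ℝ≥0∞) : EReal)

/-- `Θ` is a `T`-invariant probability measure. -/
def IsInvariantProb (T : X → X) (Θ : Measure X) : Prop :=
  IsProbabilityMeasure Θ ∧ MeasurePreserving T Θ Θ

/-- The pressure of the energy function `f`, for a transformation `T` of finite topological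
entropy. -/
def pressure (T : X → X) (f : X → EReal) : EReal :=
  ⨆ (Θ : Measure X) (_ : IsInvariantProb T Θ), ksEntropy Θ T + energyIntegral Θ f

/-- `Λ` is an equilibrium state for the energy function `f`. -/
def IsEquilibriumState (T : X → X) (f : X → EReal) (Λ : Measure X) : Prop :=
  IsInvariantProb T Λ ∧ ksEntropy Λ T + energyIntegral Λ f = pressure T f

end Thermodynamics

/-! ## The code space -/

section CodeSpace

variable {E : Type*}

/-- The `j`-th power `S ^ j` of the left shift on the two-sided code space. For a finite discrete
alphabet `E`, the product `σ`-algebra on `ℤ → E` is the Borel `σ`-algebra of the product topology. -/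
def shiftBy (j : ℤ) (σ : ℤ → E) : ℤ → E := fun n => σ (n + j)

/-- The left shift `S`. -/
def leftShift : (ℤ → E) → (ℤ → E) := shiftBy 1

/-- The cylinder set of all `σ` with `σ m = e₁, …, σ (m + k - 1) = eₖ`. -/
def codeCylinder (m : ℤ) (l : List E) : Set (ℤ → E) :=
  {σ | ∀ (k : ℕ) (hk : k < l.length), σ (m + k) = l[k]}

end CodeSpace

/-! ## Markov systems -/

/-- A Markov system `(K_{i(e)}, w_e, p_e)_{e ∈ E}` on `K` with vertices `V` and edges `E`. -/
structure MarkovSystem (K V E : Type*) [MeasurableSpace K] [Fintype E] where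
  /-- the initial vertex `i(e)` of an edge -/
  init : E → V
  /-- the terminal vertex `t(e)` of an edge -/
  term : E → V
  /-- the vertex sets `K_i` -/
  vset : V → Set K
  vset_nonempty : ∀ i, (vset i).Nonempty
  vset_measurable : ∀ i, MeasurableSet (vset i)
  vset_disjoint : Pairwise fun i j => Disjoint (vset i) (vset j)
  vset_cover : ⋃ i, vset i = Set.univ
  /-- the maps `w_e` -/
  w : E → K → K
  w_measurable : ∀ e, Measurable (w e)
  w_mapsTo : ∀ e, Set.MapsTo (w e) (vset (init e)) (vset (term e))
  /-- the probability functions `p_e` -/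
  p : E → K → ℝ
  p_measurable : ∀ e, Measurable (p e)
  p_nonneg : ∀ e x, 0 ≤ p e x
  p_sum : ∀ x, ∑ e, p e x = 1
  p_zero : ∀ e x, x ∉ vset (init e) → p e x = 0

namespace MarkovSystem

variable {K V E : Type*} [MeasurableSpace K] [Fintype E] (𝓜 : MarkovSystem K V E)

/-- Contractiveness on average, with some rate `0 < a < 1`. -/
def IsContractive {K V E : Type*} [MetricSpace K] [MeasurableSpace K] [Fintype E]
    (𝓜 : MarkovSystem K V E) : Prop :=
  ∃ a : ℝ, 0 < a ∧ a < 1 ∧ ∀ i, ∀ x ∈ 𝓜.vset i, ∀ y ∈ 𝓜.vset i,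
    ∑ e, 𝓜.p e x * dist (𝓜.w e x) (𝓜.w e y) ≤ a * dist x y

/-- The Markov operator `U f = ∑ e, p_e · (f ∘ w_e)`. -/
def markovOp (f : K → ℝ) (x : K) : ℝ := ∑ e, 𝓜.p e x * f (𝓜.w e x)

/-- `μ` is an invariant probability measure, `U* μ = μ`: one has `∫ U f dμ = ∫ f dμ` for all bounded
Borel functions `f`. -/
def IsInvariant (μ : Measure K) : Prop :=
  IsProbabilityMeasure μ ∧ ∀ f : K → ℝ, Measurable f → (∃ C : ℝ, ∀ x, |f x| ≤ C) →
    ∫ x, 𝓜.markovOp f x ∂μ = ∫ x, f x ∂μ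

/-- `p_{e₁}(x) p_{e₂}(w_{e₁} x) ⋯ p_{eₖ}(w_{eₖ₋₁} ∘ ⋯ ∘ w_{e₁} x)` for the word `e₁ … eₖ`. -/
def pathProb : List E → K → ℝ
  | [], _ => 1
  | e :: l, x => 𝓜.p e x * pathProb l (𝓜.w e x)

/-- `M` is a generalized Markov measure associated with `𝓜` and `μ`: it has the prescribed values
on all cylinder sets. -/
def IsGeneralizedMarkovMeasure [MeasurableSpace E] (μ : Measure K) (M : Measure (ℤ → E)) : Prop :=
  ∀ (m : ℤ) (l : List E), M (codeCylinder m l) = ENNReal.ofReal (∫ x, 𝓜.pathProb l x ∂μ)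

/-! ### Existence of the generalized Markov measure -/

theorem pathProb_nonneg (l : List E) (x : K) : 0 ≤ 𝓜.pathProb l x := by
  induction l generalizing x with
  | nil => simp [pathProb]
  | cons e l ih => exact mul_nonneg (𝓜.p_nonneg e x) (ih _)

theorem pathProb_measurable (l : List E) : Measurable (𝓜.pathProb l) := by
  induction l with
  | nil => exact measurable_const
  | cons e l ih => exact (𝓜.p_measurable e).mul (ih.comp (𝓜.w_measurable e))

theorem p_le_one (e : E) (x : K) : 𝓜.p e x ≤ 1 := by
  rw [← 𝓜.p_sum x]
  exact Finset.single_le_sum (f := fun e => 𝓜.p e x) (fun i _ => 𝓜.p_nonneg i x)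
    (Finset.mem_univ e)

theorem pathProb_le_one (l : List E) (x : K) : 𝓜.pathProb l x ≤ 1 := by
  induction l generalizing x with
  | nil => simp [pathProb]
  | cons e l ih => exact mul_le_one₀ (𝓜.p_le_one e x) (𝓜.pathProb_nonneg l _) (ih _)

theorem markovOp_iterate_props (l : List E) (j : ℕ) :
    Measurable (𝓜.markovOp^[j] (𝓜.pathProb l)) ∧
      ∀ x, 0 ≤ 𝓜.markovOp^[j] (𝓜.pathProb l) x ∧ 𝓜.markovOp^[j] (𝓜.pathProb l) x ≤ 1 := by
  induction j with
  | zero => exact ⟨𝓜.pathProb_measurable l, fun x => ⟨𝓜.pathProb_nonneg l x, 𝓜.pathProb_le_one l x⟩⟩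
  | succ j ih =>
    rw [Function.iterate_succ_apply']
    refine ⟨Finset.measurable_sum _ fun e _ =>
      (𝓜.p_measurable e).mul (ih.1.comp (𝓜.w_measurable e)), fun x => ⟨?_, ?_⟩⟩
    · exact Finset.sum_nonneg fun e _ => mul_nonneg (𝓜.p_nonneg e x) (ih.2 _).1
    · rw [← 𝓜.p_sum x]
      exact Finset.sum_le_sum fun e _ => mul_le_of_le_one_right (𝓜.p_nonneg e x) (ih.2 _).2

theorem integral_markovOp_iterate {μ : Measure K} (hμ : 𝓜.IsInvariant μ) (l : List E) (j : ℕ) :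
    ∫ x, 𝓜.markovOp^[j] (𝓜.pathProb l) x ∂μ = ∫ x, 𝓜.pathProb l x ∂μ := by
  induction j with
  | zero => rfl
  | succ j ih =>
    rw [Function.iterate_succ_apply', ← ih]
    obtain ⟨h1, h2⟩ := 𝓜.markovOp_iterate_props l j
    exact hμ.2 _ h1 ⟨1, fun x => abs_le.2 ⟨by linarith [(h2 x).1], (h2 x).2⟩⟩

/-- Prefix the letter `e` to a one-sided sequence. -/
def consSeq (e : E) (τ : ℕ → E) : ℕ → E
  | 0 => e
  | n + 1 => τ n

/-- One-sided cylinder sets. -/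
def seqCylinder (j : ℕ) (l : List E) : Set (ℕ → E) :=
  {τ | ∀ (k : ℕ) (hk : k < l.length), τ (j + k) = l[k]}

theorem consSeq_preimage_succ (e : E) (j : ℕ) (l : List E) :
    consSeq e ⁻¹' seqCylinder (j + 1) l = seqCylinder j l := by
  ext τ
  simp only [seqCylinder, Set.mem_preimage, Set.mem_ofPred_eq]
  refine forall_congr' fun k => forall_congr' fun hk => ?_
  rw [show j + 1 + k = (j + k) + 1 by omega]
  rfl

theorem consSeq_preimage_zero (e a : E) (l : List E) :
    consSeq e ⁻¹' seqCylinder 0 (a :: l) = {τ | e = a ∧ τ ∈ seqCylinder 0 l} := by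
  ext τ
  simp only [seqCylinder, Set.mem_preimage, Set.mem_ofPred_eq]
  constructor
  · intro h
    refine ⟨h 0 (by simp), fun k hk => ?_⟩
    have := h (k + 1) (by simpa using hk)
    simpa [consSeq] using this
  · rintro ⟨h0, h⟩ k hk
    cases k with
    | zero => exact h0
    | succ k =>
      have := h k (by simpa using hk)
      simpa [consSeq] using this

section Existence

variable [MeasurableSpace E]

theorem measurable_consSeq (e : E) : Measurable (consSeq e) := by
  refine measurable_pi_lambda _ fun n => ?_
  cases n with
  | zero => exact measurable_const
  | succ n => exact measurable_pi_apply n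

/-- The law of the first `k` letters of the Markov process started at `x`, continued constantly. -/
def startLaw (e₀ : E) : ℕ → K → Measure (ℕ → E)
  | 0, _ => Measure.dirac fun _ => e₀
  | k + 1, x => ∑ e, ENNReal.ofReal (𝓜.p e x) • (startLaw e₀ k (𝓜.w e x)).map (consSeq e)

theorem startLaw_succ_apply (e₀ : E) (k : ℕ) (x : K) {A : Set (ℕ → E)} (hA : MeasurableSet A) :
    𝓜.startLaw e₀ (k + 1) x A =
      ∑ e, ENNReal.ofReal (𝓜.p e x) * 𝓜.startLaw e₀ k (𝓜.w e x) (consSeq e ⁻¹' A) := by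
  simp only [startLaw, Measure.finsetSum_apply, Measure.smul_apply, smul_eq_mul]
  exact Finset.sum_congr rfl fun e _ => by rw [Measure.map_apply (measurable_consSeq e) hA]

theorem startLaw_univ (e₀ : E) (k : ℕ) (x : K) : 𝓜.startLaw e₀ k x Set.univ = 1 := by
  induction k generalizing x with
  | zero => simp [startLaw]
  | succ k ih =>
    rw [startLaw_succ_apply _ _ _ _ MeasurableSet.univ]
    simp only [Set.preimage_univ, ih, mul_one]
    rw [← ENNReal.ofReal_sum_of_nonneg fun e _ => 𝓜.p_nonneg e x, 𝓜.p_sum, ENNReal.ofReal_one]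

theorem measurable_startLaw (e₀ : E) (k : ℕ) : Measurable (𝓜.startLaw e₀ k) := by
  induction k with
  | zero => exact measurable_const
  | succ k ih =>
    refine Measure.measurable_of_measurable_coe _ fun A hA => ?_
    simp only [startLaw_succ_apply _ _ _ _ hA]
    exact Finset.measurable_sum _ fun e _ => (𝓜.p_measurable e).ennreal_ofReal.mul
      ((Measure.measurable_coe (measurable_consSeq e hA)).comp (ih.comp (𝓜.w_measurable e)))

theorem measurableSet_seqCylinder [DiscreteMeasurableSpace E] (j : ℕ) (l : List E) :
    MeasurableSet (seqCylinder j l) := by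
  simp only [seqCylinder, Set.ofPred_forall]
  exact MeasurableSet.iInter fun k => MeasurableSet.iInter fun hk =>
    (MeasurableSet.of_discrete (s := {l[k]})).preimage (measurable_pi_apply (j + k))

theorem startLaw_seqCylinder [DiscreteMeasurableSpace E] (e₀ : E) (j k : ℕ) (l : List E)
    (h : j + l.length ≤ k) (x : K) : 𝓜.startLaw e₀ k x (seqCylinder j l) =
      ENNReal.ofReal (𝓜.markovOp^[j] (𝓜.pathProb l) x) := by
  induction j generalizing k x with
  | zero =>
    induction l generalizing k x with
    | nil =>
      have : seqCylinder (E := E) 0 [] = Set.univ := by ext; simp [seqCylinder]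
      rw [this, startLaw_univ]
      simp [pathProb]
    | cons a l ih =>
      obtain ⟨k, rfl⟩ : ∃ k', k = k' + 1 := ⟨k - 1, by simp at h; omega⟩
      rw [startLaw_succ_apply _ _ _ _ (measurableSet_seqCylinder _ _)]
      simp only [consSeq_preimage_zero]
      rw [Finset.sum_eq_single a]
      · simp only [true_and, Set.ofPred_mem_eq]
        rw [ih k (by simp at h ⊢; omega)]
        simp only [Function.iterate_zero, id_eq, pathProb]
        rw [ENNReal.ofReal_mul (𝓜.p_nonneg a x)]
      · intro b _ hb
        simp [hb]
      · simp
  | succ j ih =>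
    obtain ⟨k, rfl⟩ : ∃ k', k = k' + 1 := ⟨k - 1, by omega⟩
    rw [startLaw_succ_apply _ _ _ _ (measurableSet_seqCylinder _ _), Function.iterate_succ_apply']
    simp only [consSeq_preimage_succ]
    rw [markovOp, ENNReal.ofReal_sum_of_nonneg fun e _ =>
      mul_nonneg (𝓜.p_nonneg e x) ((𝓜.markovOp_iterate_props l j).2 _).1]
    refine Finset.sum_congr rfl fun e _ => ?_
    rw [ih k (by omega), ENNReal.ofReal_mul (𝓜.p_nonneg e x)]

/-- Approximations of the generalized Markov measure: the right values on the cylinder sets within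
the window from `-n` to `n - 1`. -/
theorem exists_approx [DiscreteMeasurableSpace E] {μ : Measure K} (hμ : 𝓜.IsInvariant μ) (n : ℕ) :
    ∃ M : ProbabilityMeasure (ℤ → E), ∀ (m : ℤ) (l : List E), -(n : ℤ) ≤ m →
      m + l.length ≤ n → (M : Measure (ℤ → E)) (codeCylinder m l) =
        ENNReal.ofReal (∫ x, 𝓜.pathProb l x ∂μ) := by
  have := hμ.1
  have hE : Nonempty E := by
    by_contra hne
    rw [not_nonempty_iff] at hne
    obtain ⟨x⟩ := μ.nonempty_of_neZero
    simpa using 𝓜.p_sum x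
  obtain ⟨e₀⟩ := hE
  let g : (ℕ → E) → (ℤ → E) := fun τ j => τ (j + n).toNat
  have hg : Measurable g := measurable_pi_lambda _ fun j => measurable_pi_apply _
  let B : Measure (ℕ → E) := μ.bind (𝓜.startLaw e₀ (2 * n))
  have hB : ∀ A, MeasurableSet A → B A = ∫⁻ x, 𝓜.startLaw e₀ (2 * n) x A ∂μ := fun A hA =>
    Measure.bind_apply hA (𝓜.measurable_startLaw e₀ _).aemeasurable
  have hprob : IsProbabilityMeasure (B.map g) := by
    constructor
    rw [Measure.map_apply hg MeasurableSet.univ, Set.preimage_univ, hB _ MeasurableSet.univ]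
    simp [startLaw_univ]
  refine ⟨⟨B.map g, hprob⟩, fun m l h1 h2 => ?_⟩
  have hpre : g ⁻¹' codeCylinder m l = seqCylinder (m + n).toNat l := by
    ext τ
    simp only [codeCylinder, seqCylinder, Set.mem_preimage, Set.mem_ofPred_eq, g]
    refine forall_congr' fun k => forall_congr' fun hk => ?_
    rw [show (m + k + n).toNat = (m + n).toNat + k by omega]
  have hmeas : MeasurableSet (codeCylinder m l) := by
    simp only [codeCylinder, Set.ofPred_forall]
    exact MeasurableSet.iInter fun k => MeasurableSet.iInter fun hk =>
      (MeasurableSet.of_discrete (s := {l[k]})).preimage (measurable_pi_apply (m + (k : ℤ)))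
  rw [ProbabilityMeasure.coe_mk, Measure.map_apply hg hmeas, hpre,
    hB _ (measurableSet_seqCylinder _ _)]
  obtain ⟨p1, p2⟩ := 𝓜.markovOp_iterate_props l (m + n).toNat
  simp only [𝓜.startLaw_seqCylinder e₀ (m + n).toNat (2 * n) l (by omega)]
  rw [← 𝓜.integral_markovOp_iterate hμ l (m + n).toNat, ofReal_integral_eq_lintegral_ofReal]
  · exact Integrable.of_bound p1.aestronglyMeasurable 1
      (Eventually.of_forall fun x => by
        rw [Real.norm_eq_abs, abs_of_nonneg (p2 x).1]; exact (p2 x).2)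
  · exact Eventually.of_forall fun x => (p2 x).1

theorem exists_isGeneralizedMarkovMeasure [DiscreteMeasurableSpace E] {μ : Measure K}
    (hμ : 𝓜.IsInvariant μ) : ∃ M : Measure (ℤ → E), 𝓜.IsGeneralizedMarkovMeasure μ M := by
  let _ : TopologicalSpace E := ⊥
  have : DiscreteTopology E := ⟨rfl⟩
  have : BorelSpace E := ⟨by rw [borel_eq_top_of_discrete]; ext s; simp [MeasurableSet.of_discrete]⟩
  choose M hM using fun n : ℕ => 𝓜.exists_approx hμ n
  obtain ⟨L, -, hL⟩ := isCompact_univ.exists_mapClusterPt (f := (atTop : Filter ℕ)) (u := M)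
    (by simp)
  obtain ⟨G, hG, hGL⟩ := mapClusterPt_iff_ultrafilter.1 hL
  refine ⟨L, fun m l => ?_⟩
  have hclopen : IsClopen (codeCylinder (E := E) m l) := by
    have : codeCylinder (E := E) m l = ⋂ k : Fin l.length, {σ | σ (m + k) = l[k]} := by
      ext σ
      simp [codeCylinder, Fin.forall_iff]
    rw [this]
    exact isClopen_iInter_of_finite fun k =>
      (isClopen_discrete {l[k]}).preimage (continuous_apply (m + (k : ℤ)))
  have h1 := ProbabilityMeasure.tendsto_measure_of_null_frontier_of_tendsto' hGL
    (E := codeCylinder m l) (by rw [hclopen.frontier_eq]; simp)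
  refine tendsto_nhds_unique h1 (tendsto_const_nhds.congr' ?_)
  filter_upwards [hG (eventually_ge_atTop (m.natAbs + l.length))] with n hn
  have : m.natAbs + l.length ≤ n := hn
  exact (hM n m l (by omega) (by omega)).symm

end Existence

/-- The generalized Markov measure `M` associated with `𝓜` and the invariant measure `μ`. It is the
unique measure with the prescribed values on the cylinder sets. -/
def generalizedMarkovMeasure [MeasurableSpace E] [DiscreteMeasurableSpace E] {μ : Measure K}
    (hμ : 𝓜.IsInvariant μ) : Measure (ℤ → E) :=
  Classical.choose (𝓜.exists_isGeneralizedMarkovMeasure hμ)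

theorem generalizedMarkovMeasure_spec [MeasurableSpace E] [DiscreteMeasurableSpace E]
    {μ : Measure K} (hμ : 𝓜.IsInvariant μ) :
    𝓜.IsGeneralizedMarkovMeasure μ (𝓜.generalizedMarkovMeasure hμ) :=
  Classical.choose_spec (𝓜.exists_isGeneralizedMarkovMeasure hμ)

/-! ### The coding map and the energy function -/

/-- The composition `w_{σ 0} ∘ w_{σ (-1)} ∘ ⋯ ∘ w_{σ (-n)}`. -/
def backComp (σ : ℤ → E) : ℕ → K → K
  | 0, y => 𝓜.w (σ 0) y
  | n + 1, y => backComp σ n (𝓜.w (σ (-((n : ℤ) + 1))) y)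

/-- The point `w_{σ 0} ∘ ⋯ ∘ w_{σ (-n)} (x_{i(σ (-n))})`. -/
def backPoint (x : V → K) (σ : ℤ → E) (n : ℕ) : K :=
  𝓜.backComp σ n (x (𝓜.init (σ (-(n : ℤ)))))

/-- The subshift of finite type `Σ_G` of all two-sided paths in the graph. -/
def pathSpace : Set (ℤ → E) :=
  {σ | ∀ j : ℤ, 𝓜.term (σ j) = 𝓜.init (σ (j + 1))}

/-- The set `D` of all paths along which the limit that defines the coding map exists. -/
def limitSet [TopologicalSpace K] (x : V → K) : Set (ℤ → E) :=
  {σ | σ ∈ 𝓜.pathSpace ∧ ∃ y : K, Tendsto (𝓜.backPoint x σ) atTop (𝓝 y)}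

/-- The shift invariant set `Y`, the intersection of all `S ^ j (D)`, `j ∈ ℤ`. -/
def codingDomain [TopologicalSpace K] (x : V → K) : Set (ℤ → E) :=
  ⋂ j : ℤ, shiftBy j '' 𝓜.limitSet x

open Classical in
/-- The coding map `F = F_{x_1, …, x_N}`: the limit of `w_{σ 0} ∘ ⋯ ∘ w_{σ (-n)} (x_{i(σ (-n))})`
where it exists, and some irrelevant point elsewhere. -/
def codingMap [TopologicalSpace K] (x : V → K) (σ : ℤ → E) : K :=
  if h : ∃ y : K, Tendsto (𝓜.backPoint x σ) atTop (𝓝 y) then h.choose else x (𝓜.init (σ 0))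

open Classical in
/-- The energy function `u`: `log p_{σ 1} (F σ)` on `Y`, and `-∞` off `Y`. -/
def energy [TopologicalSpace K] (x : V → K) (σ : ℤ → E) : EReal :=
  if σ ∈ 𝓜.codingDomain x then ((Real.log (𝓜.p (σ 1) (𝓜.codingMap x σ)) : ℝ) : EReal) else ⊥

end MarkovSystem

end

/-! The pressure of `u` is zero. If an invariant measure Θ is carried by Y, the numbers p_e(F σ) are
probability weights for the letter at 1 given the letters up to 0, since ∑ p_e = 1 and F reads only
the past. The Gibbs inequality then gives h_Θ(S) ≤ -∫ log p_{σ 1}(F σ) dΘ, that is h_Θ(S) + Θ(u) ≤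
0; all other measures have energy -∞. To work with finitely many letters, F is replaced by
`backPoint`, and an arbitrary finite partition by a nearby cylinder partition at a small cost in the
Gibbs weights, which takes the place of the Kolmogorov-Sinai generator theorem
(`partitionEntropy_itinerary_le`, `ksEntropy_leftShift_le`).

The measure M attains the value zero. Its cylinder probabilities are μ-averages of path
probabilities, so concavity of -t log t and the chain rule give h_M(S) ≥ -∑ ∫ p_e log p_e dμ
(`le_ksEntropy`). Contraction on average brings together the trajectories of a μ-random point and of
the base point of its vertex set when both follow the same word. Hence under M the pair (σ 1, F σ)
has the law p_e(y) dμ(y) (`integral_coding`). This yields F(M) = μ and the value of M(u), so the two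
entropy bounds meet.

For uniqueness, let Λ attain zero. Then no other weights depending on the past give a better Gibbs
bound than p_e ∘ F. Multiplying them by 1 + s χ at one letter, renormalizing and comparing first
order terms in s shows that p_e ∘ F is the conditional probability of e given the past
(`integral_ite_letter_eq`). With F ∘ S = w_{σ 1} ∘ F, this makes F(Λ) invariant, hence equal to μ,
and gives Λ the cylinder values of M. -/

noncomputable section

/-! ## Words of the code space -/

section Words

variable {E : Type*}

/-- The word `σ m, …, σ (m + n - 1)`. -/
def wordAt (m : ℤ) (n : ℕ) (σ : ℤ → E) : Fin n → E := fun j => σ (m + (j : ℕ))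

/-- The sequence that carries the word `v` at the places `m, …, m + n - 1` and is constant
elsewhere. -/
def extendWord (e₀ : E) (m : ℤ) {n : ℕ} (v : Fin n → E) : ℤ → E := fun j =>
  if h : m ≤ j ∧ j < m + n then v ⟨(j - m).toNat, by omega⟩ else e₀

theorem extendWord_apply (e₀ : E) (m : ℤ) {n : ℕ} (v : Fin n → E) (j : Fin n) :
    extendWord e₀ m v (m + (j : ℕ)) = v j := by
  have := j.2
  rw [extendWord, dif_pos (by omega)]
  congr 1
  ext
  simp

theorem extendWord_wordAt (e₀ : E) (m : ℤ) (n : ℕ) (σ : ℤ → E) {j : ℤ} (h₁ : m ≤ j)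
    (h₂ : j < m + n) : extendWord e₀ m (wordAt m n σ) j = σ j := by
  rw [extendWord, dif_pos ⟨h₁, h₂⟩, wordAt]
  congr 1
  simp only
  omega

/-- Functions of finitely many coordinates become functions on a set of words in this way. -/
theorem DependsOn.apply_extendWord {β : Type*} {f : (ℤ → E) → β} {a b : ℤ}
    (hf : DependsOn f (Set.Icc a b)) (e₀ : E) {m : ℤ} {n : ℕ} (ha : m ≤ a) (hb : b < m + n)
    (σ : ℤ → E) : f (extendWord e₀ m (wordAt m n σ)) = f σ :=
  hf fun j hj => extendWord_wordAt e₀ m n σ (by have := hj.1; omega) (by have := hj.2; omega)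

theorem shiftBy_shiftBy (i j : ℤ) (σ : ℤ → E) : shiftBy i (shiftBy j σ) = shiftBy (i + j) σ := by
  funext n
  simp only [shiftBy]
  congr 1
  ring

theorem shiftBy_zero (σ : ℤ → E) : shiftBy 0 σ = σ := by
  funext n
  simp [shiftBy]

theorem leftShift_iterate (n : ℕ) (σ : ℤ → E) : leftShift^[n] σ = shiftBy n σ := by
  induction n with
  | zero => simp [shiftBy_zero]
  | succ n ih =>
    rw [Function.iterate_succ_apply', ih, leftShift, shiftBy_shiftBy]
    push_cast
    rw [add_comm]

variable [MeasurableSpace E]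

theorem measurable_shiftBy (m : ℤ) : Measurable (shiftBy m : (ℤ → E) → ℤ → E) :=
  measurable_pi_lambda _ fun n => measurable_pi_apply (n + m)

theorem measurable_wordAt (m : ℤ) (n : ℕ) : Measurable (wordAt m n : (ℤ → E) → Fin n → E) :=
  measurable_pi_lambda _ fun _ => measurable_pi_apply _

/-- The shift by `m` as a measurable equivalence. -/
def shiftEquiv (m : ℤ) : (ℤ → E) ≃ᵐ (ℤ → E) where
  toFun := shiftBy m
  invFun := shiftBy (-m)
  left_inv σ := by rw [shiftBy_shiftBy, neg_add_cancel, shiftBy_zero]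
  right_inv σ := by rw [shiftBy_shiftBy, add_neg_cancel, shiftBy_zero]
  measurable_toFun := measurable_shiftBy m
  measurable_invFun := measurable_shiftBy (-m)

theorem measurePreserving_shiftBy {Θ : Measure (ℤ → E)} (h : MeasurePreserving leftShift Θ Θ)
    (m : ℤ) : MeasurePreserving (shiftBy m) Θ Θ := by
  have hnat : ∀ n : ℕ, MeasurePreserving (shiftBy (n : ℤ)) Θ Θ := fun n => by
    have := h.iterate n
    rwa [show (leftShift (E := E))^[n] = shiftBy (n : ℤ) from funext (leftShift_iterate n)] at this
  obtain ⟨n, rfl | rfl⟩ := m.eq_nat_or_neg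
  · exact hnat n
  · exact MeasurePreserving.symm (shiftEquiv (n : ℤ)) (hnat n)

theorem exists_dependsOn_of_mem_measurableCylinders {A : Set (ℤ → E)}
    (hA : A ∈ measurableCylinders fun _ : ℤ => E) :
    ∃ N : ℕ, DependsOn (fun σ => σ ∈ A) (Set.Icc (-(N : ℤ)) N) := by
  obtain ⟨s, S, -, rfl⟩ := (mem_measurableCylinders _).1 hA
  refine ⟨s.sup Int.natAbs, fun σ τ h => ?_⟩
  simp only [mem_cylinder]
  have : s.restrict σ = s.restrict τ := by
    funext ⟨i, hi⟩
    have : i.natAbs ≤ s.sup Int.natAbs := Finset.le_sup (f := Int.natAbs) hi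
    exact h i ⟨by omega, by omega⟩
  rw [this]

/-- A finite measurable partition of the code space is approximated by partitions into cylinder
sets. -/
theorem exists_dependsOn_measure_ne_lt (Θ : Measure (ℤ → E)) [IsFiniteMeasure Θ] {k : ℕ}
    {ξ : (ℤ → E) → Fin k} (hξ : Measurable ξ) {ε : ℝ≥0∞} (hε : 0 < ε) :
    ∃ (N : ℕ) (ζ : (ℤ → E) → Fin k), DependsOn ζ (Set.Icc (-(N : ℤ)) N) ∧ Θ {σ | ξ σ ≠ ζ σ} < ε := by
  classical
  rcases isEmpty_or_nonempty E with hE | ⟨⟨e₀⟩⟩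
  · exact ⟨0, ξ, fun σ => isEmptyElim (σ 0), by simpa using hε⟩
  let i₀ : Fin k := ξ fun _ => e₀
  have hε' : 0 < ε / k := ENNReal.div_pos hε.ne' (ENNReal.natCast_ne_top k)
  have happ : ∀ i : Fin k, ∃ t ∈ measurableCylinders fun _ : ℤ => E,
      Θ (symmDiff t (ξ ⁻¹' {i})) < ε / k := fun i =>
    exists_measure_symmDiff_lt_of_generateFrom_isSetRing isSetRing_measurableCylinders
      ⟨{Set.univ}, Set.countable_singleton _, by
        simpa only [Set.singleton_subset_iff] using univ_mem_measurableCylinders _, by simp⟩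
      generateFrom_measurableCylinders.symm (hξ (MeasurableSet.singleton i)) hε'
  choose t htm ht using happ
  choose N hN using fun i => exists_dependsOn_of_mem_measurableCylinders (htm i)
  -- The label is i where t i is the only approximating set that contains the point, and the
  -- irrelevant value i₀ elsewhere. Outside the symmetric differences this is the label of ξ.
  refine ⟨Finset.univ.sup N,
    fun σ => if h : ∃ i, σ ∈ t i ∧ ∀ j, σ ∈ t j → j = i then h.choose else i₀, ?_, ?_⟩
  · intro σ τ h
    have : ∀ i, (σ ∈ t i) = (τ ∈ t i) := fun i => hN i fun j hj => h j (by
      have : N i ≤ Finset.univ.sup N := Finset.le_sup (Finset.mem_univ i)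
      exact ⟨by have := hj.1; omega, by have := hj.2; omega⟩)
    simp only [this]
  · refine (measure_mono (t := ⋃ i, symmDiff (t i) (ξ ⁻¹' {i})) fun σ hσ => ?_).trans_lt ?_
    · by_contra hcon
      simp only [Set.mem_iUnion, Set.mem_symmDiff, Set.mem_preimage, Set.mem_singleton_iff,
        not_exists, not_or, not_and, not_not] at hcon
      have hex : ∃ i, σ ∈ t i ∧ ∀ j, σ ∈ t j → j = i :=
        ⟨ξ σ, (hcon _).2 rfl, fun j hj => ((hcon j).1 hj).symm⟩
      exact hσ (((hcon _).1 hex.choose_spec.1).trans (dif_pos hex).symm)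
    · have : NeZero k := ⟨fun h => (h ▸ i₀).elim0⟩
      calc Θ (⋃ i, symmDiff (t i) (ξ ⁻¹' {i})) ≤ ∑ i, Θ (symmDiff (t i) (ξ ⁻¹' {i})) :=
            measure_iUnion_fintype_le _ _
        _ < ∑ _i : Fin k, ε / k := ENNReal.sum_lt_sum_of_nonempty ⟨i₀, Finset.mem_univ _⟩
            fun i _ => ht i
        _ ≤ ε := by
            rw [Finset.sum_const, Finset.card_univ, Fintype.card_fin, nsmul_eq_mul]
            exact ENNReal.mul_div_le

variable [Finite E] [DiscreteMeasurableSpace E]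

/-- The function factors through the word on the interval, and on the finite set of words every
function is measurable. -/
theorem DependsOn.measurable_of_Icc {β : Type*} [MeasurableSpace β] {f : (ℤ → E) → β} {a b : ℤ}
    (hf : DependsOn f (Set.Icc a b)) : Measurable f := by
  rcases isEmpty_or_nonempty E with hE | ⟨⟨e₀⟩⟩
  · exact measurable_of_empty f
  have : f = (fun v => f (extendWord e₀ a v)) ∘ wordAt a (b + 1 - a).toNat :=
    funext fun σ => (hf.apply_extendWord e₀ le_rfl (by omega) σ).symm
  rw [this]
  exact Measurable.comp (g := fun v => f (extendWord e₀ a v)) (measurable_of_finite _)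
    (measurable_wordAt _ _)

/-- Finite measures on the code space that agree on all words are equal. -/
theorem ext_of_wordAt {Θ Θ' : Measure (ℤ → E)} [IsFiniteMeasure Θ]
    (h : ∀ (m : ℤ) (n : ℕ) (v : Fin n → E), Θ (wordAt m n ⁻¹' {v}) = Θ' (wordAt m n ⁻¹' {v})) :
    Θ = Θ' := by
  have hw : ∀ m n, Θ.map (wordAt m n) = Θ'.map (wordAt m n) := fun m n => by
    refine Measure.ext_of_singleton fun v => ?_
    rw [Measure.map_apply (measurable_wordAt m n) (MeasurableSet.singleton v),
      Measure.map_apply (measurable_wordAt m n) (MeasurableSet.singleton v), h]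
  rcases isEmpty_or_nonempty E with hE | ⟨⟨e₀⟩⟩
  · exact Subsingleton.elim _ _
  refine ext_of_generate_finite _ generateFrom_measurableCylinders.symm
    isPiSystem_measurableCylinders (fun A hA => ?_) ?_
  · obtain ⟨N, hN⟩ := exists_dependsOn_of_mem_measurableCylinders hA
    have : A = wordAt (-(N : ℤ)) (2 * N + 1) ⁻¹' {v | extendWord e₀ (-(N : ℤ)) v ∈ A} := by
      ext σ
      exact (hN.apply_extendWord e₀ le_rfl (by push_cast; omega) σ).symm.to_iff
    have hB : MeasurableSet {v : Fin (2 * N + 1) → E | extendWord e₀ (-(N : ℤ)) v ∈ A} :=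
      Set.Finite.measurableSet (Set.toFinite _)
    rw [this, ← Measure.map_apply (measurable_wordAt _ _) hB, hw,
      Measure.map_apply (measurable_wordAt _ _) hB]
  · have := congrArg (fun ν => ν Set.univ) (hw 0 0)
    simpa [Measure.map_apply (measurable_wordAt 0 0)] using this

end Words

/-! ## The Gibbs inequality -/

/-- With a_j the mass of the j-th cell, log t ≤ t - 1 at t = Q_j / a_j gives -a_j log a_j + a_j log
Q_j ≤ Q_j - a_j, and these bounds add up to at most 0. The minorant R is there because Q will be a
sum over words, of which a single term has a computable logarithm. -/
theorem partitionEntropy_le_of_le {X ι : Type*} [MeasurableSpace X] [Fintype ι] [MeasurableSpace ι]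
    [DiscreteMeasurableSpace ι] {Θ : Measure X} [IsProbabilityMeasure Θ] {ζ : X → ι}
    (hζ : Measurable ζ) {Q : ι → ℝ} (hQ0 : ∀ j, 0 ≤ Q j) (hQ : ∑ j, Q j ≤ 1) {R : X → ℝ}
    (hR : ∀ᵐ x ∂Θ, 0 < R x ∧ R x ≤ Q (ζ x)) (hint : Integrable (fun x => Real.log (R x)) Θ) :
    partitionEntropy Θ ζ ≤ -∫ x, Real.log (R x) ∂Θ := by
  have : IsProbabilityMeasure (Θ.map ζ) := Measure.isProbabilityMeasure_map hζ.aemeasurable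
  have hreal : ∀ j, (Θ.map ζ).real {j} = Θ.real (ζ ⁻¹' {j}) := fun j =>
    map_measureReal_apply hζ (MeasurableSet.singleton j)
  have hsum : ∑ j, Θ.real (ζ ⁻¹' {j}) = 1 := by
    simp_rw [← hreal]
    simp
  have hle : ∫ x, Real.log (R x) ∂Θ ≤ ∑ j, Θ.real (ζ ⁻¹' {j}) * Real.log (Q j) := by
    have hi : Integrable (fun j => Real.log (Q j)) (Θ.map ζ) := .of_finite
    calc ∫ x, Real.log (R x) ∂Θ ≤ ∫ x, Real.log (Q (ζ x)) ∂Θ := by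
          refine integral_mono_ae hint (hi.comp_measurable hζ) ?_
          filter_upwards [hR] with x hx
          exact Real.log_le_log hx.1 hx.2
      _ = ∫ j, Real.log (Q j) ∂(Θ.map ζ) :=
          (integral_map (f := fun j => Real.log (Q j)) hζ.aemeasurable
            (measurable_of_finite _).aestronglyMeasurable).symm
      _ = _ := by
          rw [integral_fintype hi]
          simp [hreal]
  have hterm : ∀ j, Real.negMulLog (Θ.real (ζ ⁻¹' {j})) + Θ.real (ζ ⁻¹' {j}) * Real.log (Q j) ≤
      Q j - Θ.real (ζ ⁻¹' {j}) := fun j => by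
    rcases (measureReal_nonneg (μ := Θ) (s := ζ ⁻¹' {j})).eq_or_lt with h | h
    · rw [← h]
      simpa using hQ0 j
    · have hQj : 0 < Q j := by
        by_contra hcon
        refine h.ne' ((measureReal_eq_zero_iff (measure_ne_top _ _)).2 ?_)
        refine measure_mono_null (fun x hx => ?_) hR
        rintro ⟨h1, h2⟩
        rw [show ζ x = j from hx] at h2
        linarith
      set a := Θ.real (ζ ⁻¹' {j})
      have := Real.log_le_sub_one_of_pos (div_pos hQj h)
      rw [Real.log_div hQj.ne' h.ne'] at this
      calc Real.negMulLog a + a * Real.log (Q j) = a * (Real.log (Q j) - Real.log a) := by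
            rw [Real.negMulLog]; ring
        _ ≤ a * (Q j / a - 1) := mul_le_mul_of_nonneg_left this h.le
        _ = Q j - a := by field_simp
  have := Finset.sum_le_sum fun j (_ : j ∈ Finset.univ) => hterm j
  rw [Finset.sum_add_distrib, Finset.sum_sub_distrib, hsum] at this
  rw [partitionEntropy]
  linarith

/-! ## An upper bound for the entropy of the shift -/

section EntropyBound

variable {E : Type*} [Fintype E]

/-- The k-th factor reads the letters at m, …, m + k + 1. Summing over the last letter first
therefore affects only the last factor, whose sum is at most 1. The first letter has no weight and
accounts for the bound `Fintype.card E`. -/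
theorem sum_prod_extendWord_le (e₀ : E) {r : ℕ → (ℤ → E) → ℝ}
    (hdep : ∀ k : ℕ, DependsOn (r k) (Set.Icc (-(k : ℤ)) 1)) (h0 : ∀ k σ, 0 ≤ r k σ)
    (hsum : ∀ k σ, ∑ e, r k (Function.update σ 1 e) ≤ 1) (m : ℤ) (n : ℕ) :
    ∑ v : Fin (n + 1) → E, ∏ k ∈ Finset.range n, r k (shiftBy (k + m) (extendWord e₀ m v)) ≤
      Fintype.card E := by
  induction n with
  | zero => simp
  | succ n ih =>
    rw [← (Fin.snocEquiv fun _ : Fin (n + 1 + 1) => E).sum_comp, Fintype.sum_prod_type_right]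
    refine le_trans (Finset.sum_le_sum fun v _ => ?_) ih
    have hext : ∀ (e : E) (j : ℤ), m ≤ j → j ≤ m + n →
        extendWord e₀ m (Fin.snoc (α := fun _ => E) v e) j = extendWord e₀ m v j := by
      intro e j h1 h2
      rw [extendWord, extendWord, dif_pos (by push_cast; omega), dif_pos (by push_cast; omega)]
      rw [show (⟨(j - m).toNat, by omega⟩ : Fin (n + 1 + 1)) =
        Fin.castSucc ⟨(j - m).toNat, by omega⟩ from rfl, Fin.snoc_castSucc]
    calc ∑ e, ∏ k ∈ Finset.range (n + 1),
            r k (shiftBy (k + m) (extendWord e₀ m (Fin.snoc (α := fun _ => E) v e)))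
        = ∑ e, (∏ k ∈ Finset.range n, r k (shiftBy (k + m) (extendWord e₀ m v))) *
            r n (Function.update (shiftBy (n + m) (extendWord e₀ m v)) 1 e) := by
          refine Finset.sum_congr rfl fun e _ => ?_
          rw [Finset.prod_range_succ]
          congr 1
          · refine Finset.prod_congr rfl fun k hk => hdep k fun j hj => ?_
            have := Finset.mem_range.1 hk
            exact hext e _ (by have := hj.1; omega) (by have := hj.2; omega)
          · refine hdep n fun j hj => ?_
            rcases eq_or_ne j 1 with rfl | hj1
            · rw [Function.update_self]
              have := extendWord_apply e₀ m (Fin.snoc (α := fun _ => E) v e) (Fin.last (n + 1))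
              rw [Fin.snoc_last] at this
              refine Eq.trans (congrArg (extendWord e₀ m (Fin.snoc (α := fun _ => E) v e)) ?_) this
              simp only [Fin.val_last]
              push_cast
              ring
            · rw [Function.update_of_ne hj1]
              exact hext e _ (by have := hj.1; omega) (by have := hj.2; omega)
      _ ≤ _ := by
          rw [← Finset.mul_sum]
          exact mul_le_of_le_one_right (Finset.prod_nonneg fun k _ => h0 _ _) (hsum n _)

variable [MeasurableSpace E] [DiscreteMeasurableSpace E]

/-- The entropy of a partition of the code space is bounded by means of subprobability weights of
the letters given the past, and an approximating partition `ζ` into cylinder sets. -/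
theorem partitionEntropy_itinerary_le {Θ : Measure (ℤ → E)} [IsProbabilityMeasure Θ]
    (hΘ : MeasurePreserving leftShift Θ Θ) {r : ℕ → (ℤ → E) → ℝ}
    (hdep : ∀ k : ℕ, DependsOn (r k) (Set.Icc (-(k : ℤ)) 1)) (h0 : ∀ k σ, 0 ≤ r k σ)
    (hsum : ∀ k σ, ∑ e, r k (Function.update σ 1 e) ≤ 1)
    (hpos : ∀ k, ∀ᵐ σ ∂Θ, 0 < r k σ) (hint : ∀ k, Integrable (fun σ => Real.log (r k σ)) Θ)
    {d : ℕ} {ξ : (ℤ → E) → Fin d} (hξ : Measurable ξ) {N : ℕ} {ζ : (ℤ → E) → Fin d}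
    (hζ : DependsOn ζ (Set.Icc (-(N : ℤ)) N)) {c : Fin d → Fin d → ℝ} (hc0 : ∀ i j, 0 < c i j)
    (hc : ∀ j, ∑ i, c i j ≤ 1) (n : ℕ) :
    partitionEntropy Θ (itinerary leftShift ξ n) ≤ Real.log (Fintype.card E) -
      ∑ k ∈ Finset.range (n + 2 * N), ∫ σ, Real.log (r k σ) ∂Θ -
      n * ∫ σ, Real.log (c (ξ σ) (ζ σ)) ∂Θ := by
  obtain ⟨σ₀⟩ := Θ.nonempty_of_neZero
  let e₀ := σ₀ 0
  have : Nonempty E := ⟨e₀⟩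
  have hcard : (0 : ℝ) < Fintype.card E := by exact_mod_cast Fintype.card_pos
  have hshift := measurePreserving_shiftBy hΘ
  have hζm : Measurable ζ := hζ.measurable_of_Icc
  have hci : Integrable (fun σ => Real.log (c (ξ σ) (ζ σ))) Θ :=
    (Integrable.of_finite (μ := Θ.map fun σ => (ξ σ, ζ σ))
      (f := fun q : Fin d × Fin d => Real.log (c q.1 q.2))).comp_measurable (hξ.prodMk hζm)
  -- The window from -N to n + N contains all letters read by ζ along the first n iterates. G weighs
  -- its letters one after another, and C weighs the labels of ξ given those of ζ, because ξ itself
  -- need not be determined by finitely many letters.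
  let m : ℤ := -N
  let L := n + 2 * N
  let G : (ℤ → E) → ℝ := fun σ => ∏ k ∈ Finset.range L, r k (shiftBy (k + m) σ)
  let C : (Fin n → Fin d) → (ℤ → E) → ℝ := fun l σ => ∏ j : Fin n, c (l j) (ζ (shiftBy (j : ℕ) σ))
  have hG : DependsOn G (Set.Icc m (m + L)) := by
    intro σ τ h
    refine Finset.prod_congr rfl fun k hk => hdep k fun j hj => h _ ?_
    have := Finset.mem_range.1 hk
    exact ⟨by have := hj.1; omega, by have := hj.2; omega⟩
  have hC : ∀ l, DependsOn (C l) (Set.Icc m (m + L)) := by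
    intro l σ τ h
    refine Finset.prod_congr rfl fun k _ => ?_
    congr 1
    refine hζ fun j hj => h _ ?_
    have := k.2
    simp only [m, L]
    push_cast
    exact ⟨by have := hj.1; omega, by have := hj.2; omega⟩
  -- R is the term of Q that belongs to the word of σ itself. The factor in front is the uniform
  -- weight of the first letter.
  let R : (ℤ → E) → ℝ := fun σ => (Fintype.card E : ℝ)⁻¹ * (G σ * C (itinerary leftShift ξ n σ) σ)
  let Q : (Fin n → Fin d) → ℝ := fun l => ∑ v : Fin (L + 1) → E,
    (Fintype.card E : ℝ)⁻¹ * (G (extendWord e₀ m v) * C l (extendWord e₀ m v))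
  have hG0 : ∀ σ, 0 ≤ G σ := fun σ => Finset.prod_nonneg fun k _ => h0 _ _
  have hC0 : ∀ l σ, 0 < C l σ := fun l σ => Finset.prod_pos fun k _ => hc0 _ _
  have hterm0 : ∀ l σ, 0 ≤ (Fintype.card E : ℝ)⁻¹ * (G σ * C l σ) := fun l σ =>
    mul_nonneg (inv_nonneg.2 hcard.le) (mul_nonneg (hG0 σ) (hC0 l σ).le)
  have hCsum : ∀ σ, ∑ l, C l σ ≤ 1 := fun σ => by
    have := Finset.prod_univ_sum (fun _ : Fin n => (Finset.univ : Finset (Fin d)))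
      fun (j : Fin n) i => c i (ζ (shiftBy ((j : ℕ) : ℤ) σ))
    rw [Fintype.piFinset_univ] at this
    rw [← this]
    exact Finset.prod_le_one (fun j _ => Finset.sum_nonneg fun i _ => (hc0 _ _).le)
      fun j _ => hc _
  have hQsum : ∑ l, Q l ≤ 1 := by
    calc ∑ l, Q l = ∑ v : Fin (L + 1) → E, (Fintype.card E : ℝ)⁻¹ *
          (G (extendWord e₀ m v) * ∑ l, C l (extendWord e₀ m v)) := by
          rw [Finset.sum_comm]
          simp_rw [Finset.mul_sum]
      _ ≤ ∑ v : Fin (L + 1) → E, (Fintype.card E : ℝ)⁻¹ * G (extendWord e₀ m v) :=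
          Finset.sum_le_sum fun v _ => mul_le_mul_of_nonneg_left
            (mul_le_of_le_one_right (hG0 _) (hCsum _)) (inv_nonneg.2 hcard.le)
      _ ≤ (Fintype.card E : ℝ)⁻¹ * Fintype.card E := by
          rw [← Finset.mul_sum]
          exact mul_le_mul_of_nonneg_left (sum_prod_extendWord_le e₀ hdep h0 hsum m L)
            (inv_nonneg.2 hcard.le)
      _ = 1 := inv_mul_cancel₀ hcard.ne'
  have hRQ : ∀ σ, R σ ≤ Q (itinerary leftShift ξ n σ) := fun σ => by
    have h1 := Finset.single_le_sum (f := fun v : Fin (L + 1) → E => (Fintype.card E : ℝ)⁻¹ *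
      (G (extendWord e₀ m v) * C (itinerary leftShift ξ n σ) (extendWord e₀ m v)))
      (fun v _ => hterm0 _ _) (Finset.mem_univ (wordAt m (L + 1) σ))
    rwa [hG.apply_extendWord e₀ le_rfl (by push_cast; omega),
      (hC _).apply_extendWord e₀ le_rfl (by push_cast; omega)] at h1
  have hall : ∀ᵐ σ ∂Θ, ∀ k, 0 < r k (shiftBy (k + m) σ) :=
    ae_all_iff.2 fun k => (hshift (k + m)).quasiMeasurePreserving.ae (hpos k)
  have hlog : ∀ᵐ σ ∂Θ, Real.log (R σ) = -Real.log (Fintype.card E) +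
      (∑ k ∈ Finset.range L, Real.log (r k (shiftBy (k + m) σ)) +
        ∑ j : Fin n, Real.log (c (ξ (shiftBy (j : ℕ) σ)) (ζ (shiftBy (j : ℕ) σ)))) := by
    filter_upwards [hall] with σ hσ
    rw [Real.log_mul (inv_pos.2 hcard).ne'
      (mul_pos (Finset.prod_pos fun k _ => hσ k) (hC0 _ _)).ne',
      Real.log_mul (Finset.prod_pos fun k _ => hσ k).ne' (hC0 _ _).ne', Real.log_inv,
      Real.log_prod fun k _ => (hσ k).ne', Real.log_prod fun k _ => (hc0 _ _).ne']
    simp only [itinerary, leftShift_iterate]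
  have hi1 : ∀ k : ℕ, Integrable (fun σ => Real.log (r k (shiftBy (k + m) σ))) Θ := fun k =>
    (hshift (k + m)).integrable_comp_of_integrable (hint k)
  have hi2 : ∀ j : Fin n, Integrable
      (fun σ => Real.log (c (ξ (shiftBy (j : ℕ) σ)) (ζ (shiftBy (j : ℕ) σ)))) Θ := fun j =>
    (hshift _).integrable_comp_of_integrable hci
  have hs1 := integrable_finsetSum (Finset.range L) fun k _ => hi1 k
  have hs2 := integrable_finsetSum Finset.univ fun j _ => hi2 j
  have hRint : Integrable (fun σ => Real.log (R σ)) Θ :=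
    ((integrable_const _).add (hs1.add hs2)).congr (hlog.mono fun σ h => h.symm)
  have hshint : ∀ (f : (ℤ → E) → ℝ) (k : ℤ), ∫ σ, f (shiftBy k σ) ∂Θ = ∫ σ, f σ ∂Θ := fun f k =>
    (hshift k).integral_comp' (f := shiftEquiv k) f
  have hitm : Measurable (itinerary leftShift ξ n) := measurable_pi_lambda _ fun j =>
    hξ.comp (hΘ.measurable.iterate j)
  refine (partitionEntropy_le_of_le hitm (fun l => Finset.sum_nonneg fun v _ => hterm0 l _) hQsum
    (R := R) (hall.mono fun σ hσ => ⟨mul_pos (inv_pos.2 hcard)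
      (mul_pos (Finset.prod_pos fun k _ => hσ k) (hC0 _ _)), hRQ σ⟩) hRint).trans_eq ?_
  have hadd := integral_add (integrable_const (-Real.log (Fintype.card E))) (hs1.add hs2)
  simp only [Pi.add_apply] at hadd
  rw [integral_congr_ae hlog, hadd, integral_add hs1 hs2, integral_finsetSum _ fun k _ => hi1 k, integral_finsetSum _ fun j _ =>
    hi2 j]
  simp only [hshint (fun σ => Real.log (c (ξ σ) (ζ σ))), fun k : ℕ => hshint (fun σ =>
    Real.log (r k σ))]
  simp
  ring

/-- The entropy of the shift is at most the mean of `-log r` if `r` is the limit of weights `r k` of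
the letter at `1` given the letters at `-k, …, 0`. -/
theorem ksEntropy_leftShift_le {Θ : Measure (ℤ → E)} (hΘ : IsInvariantProb leftShift Θ)
    {r : ℕ → (ℤ → E) → ℝ} {r' : (ℤ → E) → ℝ} {c : ℝ} (hc : 0 < c)
    (hdep : ∀ k : ℕ, DependsOn (r k) (Set.Icc (-(k : ℤ)) 1)) (h0 : ∀ k σ, 0 ≤ r k σ)
    (hsum : ∀ k σ, ∑ e, r k (Function.update σ 1 e) ≤ 1)
    (hlow : ∀ᵐ σ ∂Θ, ∀ k, c ≤ r k σ)
    (hlim : ∀ᵐ σ ∂Θ, Tendsto (fun k => r k σ) atTop (𝓝 (r' σ))) :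
    ksEntropy Θ (leftShift : (ℤ → E) → (ℤ → E)) ≤ ((-∫ σ, Real.log (r' σ) ∂Θ : ℝ) : EReal) := by
  have := hΘ.1
  have hle : ∀ k σ, r k σ ≤ 1 := fun k σ => by
    refine le_trans ?_ (hsum k σ)
    have := Finset.single_le_sum (f := fun e => r k (Function.update σ 1 e)) (fun e _ => h0 _ _)
      (Finset.mem_univ (σ 1))
    rwa [Function.update_eq_self] at this
  have hbound : ∀ k, ∀ᵐ σ ∂Θ, ‖Real.log (r k σ)‖ ≤ -Real.log c := fun k => by
    filter_upwards [hlow] with σ hσ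
    rw [Real.norm_eq_abs, abs_of_nonpos (Real.log_nonpos (h0 k σ) (hle k σ))]
    exact neg_le_neg (Real.log_le_log hc (hσ k))
  have hmeas : ∀ k, Measurable fun σ => Real.log (r k σ) := fun k =>
    Real.measurable_log.comp (hdep k).measurable_of_Icc
  have hint : ∀ k, Integrable (fun σ => Real.log (r k σ)) Θ := fun k =>
    Integrable.of_bound (hmeas k).aestronglyMeasurable _ (hbound k)
  have htend : Tendsto (fun k => ∫ σ, Real.log (r k σ) ∂Θ) atTop
      (𝓝 (∫ σ, Real.log (r' σ) ∂Θ)) := by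
    refine tendsto_integral_of_dominated_convergence (fun _ => -Real.log c)
      (fun k => (hmeas k).aestronglyMeasurable) (integrable_const _) hbound ?_
    filter_upwards [hlow, hlim] with σ h1 h2
    exact h2.log (hc.trans_le (ge_of_tendsto' h2 h1)).ne'
  refine iSup_le fun d => iSup_le fun ξ => iSup_le fun hξ => ?_
  rw [← EReal.le_of_forall_lt_iff_le]
  intro z hz
  set a := ∫ σ, Real.log (r' σ) ∂Θ
  have hz' : -a < z := by exact_mod_cast hz
  obtain ⟨σ₀⟩ := Θ.nonempty_of_neZero
  have hd : (1 : ℝ) ≤ d := by exact_mod_cast (ξ σ₀).pos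
  let ε := z + a
  have hε : 0 < ε := by simp only [ε]; linarith
  -- Thus log (1 - η) = -ε / 2 is the cost of a label on which ξ and ζ agree. A disagreement costs L
  -- = -log (η / d).
  let η := 1 - Real.exp (-(ε / 2))
  have hη0 : 0 < η := by
    simp only [η, sub_pos, Real.exp_lt_one_iff]
    linarith
  have hη1 : η < 1 := by
    simp only [η]
    linarith [Real.exp_pos (-(ε / 2))]
  have hηd : 0 < η / d := div_pos hη0 (by linarith)
  let L := -Real.log (η / d)
  have hL : 0 ≤ L := neg_nonneg.2 (Real.log_nonpos hηd.le ((div_le_self hη0.le hd).trans hη1.le))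
  let q : Fin d → Fin d → ℝ := fun i j => if i = j then 1 - η else η / d
  have hq0 : ∀ i j, 0 < q i j := fun i j => by
    simp only [q]
    split_ifs
    · linarith
    · exact hηd
  have hq : ∀ j, ∑ i, q i j ≤ 1 := fun j => by
    calc ∑ i, q i j ≤ ∑ i, ((if i = j then 1 - η else 0) + η / d) :=
          Finset.sum_le_sum fun i _ => by
            simp only [q]
            split_ifs <;> linarith
      _ = 1 := by
          rw [Finset.sum_add_distrib, Finset.sum_ite_eq' Finset.univ j, if_pos (Finset.mem_univ j),
            Finset.sum_const, Finset.card_univ, Fintype.card_fin, nsmul_eq_mul,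
            mul_div_cancel₀ _ (by linarith)]
          ring
  -- The tolerance makes the disagreements cost at most ε / 2 in the mean.
  obtain ⟨N, ζ, hζ, hne⟩ := exists_dependsOn_measure_ne_lt Θ hξ
    (ε := ENNReal.ofReal (ε / (2 * (L + 1)))) (ENNReal.ofReal_pos.2 (by positivity))
  have hζm : Measurable ζ := hζ.measurable_of_Icc
  have hneq : MeasurableSet {σ | ξ σ ≠ ζ σ} := (measurableSet_eq_fun hξ hζm).compl
  have hP : L * Θ.real {σ | ξ σ ≠ ζ σ} ≤ ε / 2 := by
    have h1 : Θ.real {σ | ξ σ ≠ ζ σ} ≤ ε / (2 * (L + 1)) :=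
      ENNReal.toReal_le_of_le_ofReal (by positivity) hne.le
    calc L * Θ.real {σ | ξ σ ≠ ζ σ} ≤ L * (ε / (2 * (L + 1))) := mul_le_mul_of_nonneg_left h1 hL
      _ = L / (L + 1) * (ε / 2) := by field_simp
      _ ≤ 1 * (ε / 2) := mul_le_mul_of_nonneg_right
          ((div_le_one (by positivity)).2 (by linarith)) (by positivity)
      _ = ε / 2 := one_mul _
  have hqint : -ε ≤ ∫ σ, Real.log (q (ξ σ) (ζ σ)) ∂Θ := by
    have h1 : Integrable ({σ | ξ σ ≠ ζ σ}.indicator fun _ => L) Θ :=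
      (integrable_const L).indicator hneq
    calc -ε ≤ -(ε / 2) - L * Θ.real {σ | ξ σ ≠ ζ σ} := by linarith
      _ = ∫ σ, (-(ε / 2) - {σ | ξ σ ≠ ζ σ}.indicator (fun _ => L) σ) ∂Θ := by
          rw [integral_sub (integrable_const _) h1, integral_indicator_const L hneq]
          simp [mul_comm]
      _ ≤ _ := by
          refine integral_mono ((integrable_const _).sub h1)
            ((Integrable.of_finite (μ := Θ.map fun σ => (ξ σ, ζ σ))
              (f := fun x : Fin d × Fin d => Real.log (q x.1 x.2))).comp_measurable
                (hξ.prodMk hζm)) fun σ => ?_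
          by_cases h : ξ σ = ζ σ
          · simp [h, q, η]
          · simp only [q, L, if_neg h]
            rw [Set.indicator_of_mem (by exact h)]
            linarith
  let S₀ := ∑ k ∈ Finset.range (2 * N), ∫ σ, Real.log (r k σ) ∂Θ
  -- The bound divided by n: the first 2N weights are put into S₀, which vanishes in the limit, and
  -- the others form a Cesàro mean with limit a, so b tends to -a + ε = z.
  let b : ℕ → ℝ := fun n => (Real.log (Fintype.card E) - S₀) * (n : ℝ)⁻¹ -
    (n : ℝ)⁻¹ * ∑ k ∈ Finset.range n, ∫ σ, Real.log (r (k + 2 * N) σ) ∂Θ + ε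
  have hb : Tendsto b atTop (𝓝 z) := by
    have h1 := ((tendsto_add_atTop_iff_nat (2 * N)).2 htend).cesaro
    have h2 := (tendsto_inv_atTop_nhds_zero_nat (𝕜 := ℝ)).const_mul
      (Real.log (Fintype.card E) - S₀)
    have := (h2.sub h1).add_const ε
    convert this using 2
    simp only [ε]
    ring
  have hHb : ∀ᶠ n : ℕ in atTop, ((partitionEntropy Θ (itinerary leftShift ξ n) / n : ℝ) : EReal) ≤
      (b n : EReal) := by
    filter_upwards [eventually_gt_atTop 0] with n hn
    have hn' : (0 : ℝ) < n := by exact_mod_cast hn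
    refine EReal.coe_le_coe_iff.2 ?_
    have hH := partitionEntropy_itinerary_le hΘ.2 hdep h0 hsum
      (fun k => hlow.mono fun σ h => hc.trans_le (h k)) hint hξ hζ hq0 hq n
    rw [add_comm n, Finset.sum_range_add] at hH
    rw [div_le_iff₀ hn']
    have h3 : -(n * ∫ σ, Real.log (q (ξ σ) (ζ σ)) ∂Θ) ≤ n * ε := by
      have := mul_le_mul_of_nonneg_left hqint hn'.le
      linarith
    refine hH.trans (le_of_eq_of_le (sub_eq_add_neg _ _) ((add_le_add_right h3 _).trans_eq ?_))
    simp only [b, S₀, add_comm (2 * N)]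
    field_simp
    ring
  calc _ ≤ limsup (fun n => (b n : EReal)) atTop := limsup_le_limsup hHb
    _ = z := ((continuous_coe_real_ereal.tendsto z).comp hb).limsup_eq

end EntropyBound

namespace MarkovSystem

/-! ## Vertex sets and continuity -/

section Vertices

variable {K V E : Type*} [MeasurableSpace K] [Fintype E] (𝓜 : MarkovSystem K V E)

theorem exists_mem_vset (y : K) : ∃ i, y ∈ 𝓜.vset i := by
  have : y ∈ ⋃ i, 𝓜.vset i := by rw [𝓜.vset_cover]; trivial
  simpa using this

theorem vset_eq_of_mem {y : K} {i j : V} (hi : y ∈ 𝓜.vset i) (hj : y ∈ 𝓜.vset j) : i = j := by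
  by_contra h
  exact Set.disjoint_left.1 (𝓜.vset_disjoint h) hi hj

theorem mem_vset_of_p_ne_zero {e : E} {y : K} (h : 𝓜.p e y ≠ 0) : y ∈ 𝓜.vset (𝓜.init e) := by
  by_contra hy
  exact h (𝓜.p_zero e y hy)

theorem indicator_p (e : E) : (𝓜.vset (𝓜.init e)).indicator (𝓜.p e) = 𝓜.p e :=
  Set.indicator_eq_self.2 fun _ hy => 𝓜.mem_vset_of_p_ne_zero hy

theorem measurable_markovOp {f : K → ℝ} (hf : Measurable f) : Measurable (𝓜.markovOp f) :=
  Finset.measurable_sum _ fun e _ => (𝓜.p_measurable e).mul (hf.comp (𝓜.w_measurable e))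

theorem sum_p_mul_le {x : K} {f : E → ℝ} {c : ℝ} (h : ∀ e, 𝓜.p e x ≠ 0 → f e ≤ c) :
    ∑ e, 𝓜.p e x * f e ≤ c := by
  calc ∑ e, 𝓜.p e x * f e ≤ ∑ e, 𝓜.p e x * c := Finset.sum_le_sum fun e _ => by
        rcases eq_or_ne (𝓜.p e x) 0 with h0 | h0
        · simp [h0]
        · exact mul_le_mul_of_nonneg_left (h e h0) (𝓜.p_nonneg e x)
    _ = c := by rw [← Finset.sum_mul, 𝓜.p_sum, one_mul]

theorem abs_sum_p_mul_le {x : K} {f : E → ℝ} {c : ℝ} (h : ∀ e, |f e| ≤ c) :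
    |∑ e, 𝓜.p e x * f e| ≤ c := by
  refine (Finset.abs_sum_le_sum_abs _ _).trans ?_
  simp_rw [abs_mul, abs_of_nonneg (𝓜.p_nonneg _ x)]
  exact 𝓜.sum_p_mul_le fun e _ => h e

end Vertices

section Continuity

variable {K V E : Type*} [MetricSpace K] [MeasurableSpace K] [Fintype E] {𝓜 : MarkovSystem K V E}

theorem isClosed_vset (hopen : ∀ i, IsOpen (𝓜.vset i)) (i : V) : IsClosed (𝓜.vset i) := by
  have : (𝓜.vset i)ᶜ = ⋃ j ∈ {j | j ≠ i}, 𝓜.vset j := by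
    ext y
    simp only [Set.mem_compl_iff, Set.mem_iUnion, Set.mem_ofPred_eq, exists_prop]
    constructor
    · intro hy
      obtain ⟨j, hj⟩ := 𝓜.exists_mem_vset y
      exact ⟨j, fun h => hy (h ▸ hj), hj⟩
    · rintro ⟨j, hne, hj⟩ hi
      exact hne (𝓜.vset_eq_of_mem hj hi)
  rw [← isOpen_compl_iff, this]
  exact isOpen_biUnion fun j _ => hopen j

/-- A vertex set is clopen and has no frontier, so extension by zero creates no discontinuity. -/
theorem continuous_indicator_vset (hopen : ∀ i, IsOpen (𝓜.vset i)) {i : V} {f : K → ℝ}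
    (hf : ContinuousOn f (𝓜.vset i)) : Continuous ((𝓜.vset i).indicator f) := by
  have hc := isClosed_vset hopen i
  refine continuous_indicator (fun a ha => ?_) (by rwa [hc.closure_eq])
  rw [IsClopen.frontier_eq ⟨hc, hopen i⟩] at ha
  exact ha.elim

theorem continuous_p (hopen : ∀ i, IsOpen (𝓜.vset i))
    (hcont : ∀ e, UniformContinuousOn (𝓜.p e) (𝓜.vset (𝓜.init e))) (e : E) :
    Continuous (𝓜.p e) := by
  rw [← 𝓜.indicator_p e]
  exact continuous_indicator_vset hopen (hcont e).continuousOn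

/-- A single term of the contraction inequality, with p_e ≥ δ, makes w_e Lipschitz with constant a /
δ on its vertex set. -/
theorem continuousOn_w (hcontr : 𝓜.IsContractive)
    (hpos : ∃ δ : ℝ, 0 < δ ∧ ∀ e, ∀ y ∈ 𝓜.vset (𝓜.init e), δ ≤ 𝓜.p e y) (e : E) :
    ContinuousOn (𝓜.w e) (𝓜.vset (𝓜.init e)) := by
  obtain ⟨δ, hδ, hδp⟩ := hpos
  obtain ⟨a, ha0, -, ha⟩ := hcontr
  refine (LipschitzOnWith.of_dist_le_mul (K := (a / δ).toNNReal) fun y hy z hz => ?_).continuousOn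
  rw [Real.coe_toNNReal _ (by positivity), div_mul_eq_mul_div, le_div_iff₀' hδ]
  calc δ * dist (𝓜.w e y) (𝓜.w e z) ≤ 𝓜.p e y * dist (𝓜.w e y) (𝓜.w e z) :=
        mul_le_mul_of_nonneg_right (hδp e y hy) dist_nonneg
    _ ≤ ∑ e, 𝓜.p e y * dist (𝓜.w e y) (𝓜.w e z) :=
        Finset.single_le_sum (f := fun e => 𝓜.p e y * dist (𝓜.w e y) (𝓜.w e z))
          (fun e _ => mul_nonneg (𝓜.p_nonneg e y) dist_nonneg) (Finset.mem_univ e)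
    _ ≤ a * dist y z := ha _ y hy z hz

end Continuity

/-! ## The coding map -/

section Coding

variable {K V E : Type*} [MeasurableSpace K] [Fintype E] {𝓜 : MarkovSystem K V E}

theorem dependsOn_backComp (n : ℕ) :
    DependsOn (fun σ => 𝓜.backComp σ n) (Set.Icc (-(n : ℤ)) 0) := by
  induction n with
  | zero =>
    intro σ τ h
    funext y
    simp only [backComp]
    rw [h 0 (by simp)]
  | succ n ih =>
    intro σ τ h
    funext y
    simp only [backComp]
    rw [h (-((n : ℤ) + 1)) ⟨by push_cast; omega, by omega⟩]
    exact congrFun (ih fun j hj => h j ⟨by have := hj.1; push_cast; omega, hj.2⟩) _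

theorem dependsOn_backPoint (x : V → K) (n : ℕ) :
    DependsOn (fun σ => 𝓜.backPoint x σ n) (Set.Icc (-(n : ℤ)) 0) := by
  intro σ τ h
  simp only [backPoint]
  rw [h (-(n : ℤ)) ⟨le_rfl, by omega⟩]
  exact congrFun (dependsOn_backComp n h) _

theorem backComp_mem {σ : ℤ → E} (hσ : σ ∈ 𝓜.pathSpace) (n : ℕ) {y : K}
    (hy : y ∈ 𝓜.vset (𝓜.init (σ (-(n : ℤ))))) : 𝓜.backComp σ n y ∈ 𝓜.vset (𝓜.init (σ 1)) := by
  induction n generalizing y with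
  | zero =>
    have := 𝓜.w_mapsTo (σ 0) (by simpa using hy)
    rwa [hσ 0] at this
  | succ n ih =>
    refine ih ?_
    have := 𝓜.w_mapsTo (σ (-((n : ℤ) + 1))) (by simpa using hy)
    rw [hσ] at this
    convert this using 4
    ring

theorem backPoint_mem {x : V → K} (hx : ∀ i, x i ∈ 𝓜.vset i) {σ : ℤ → E} (hσ : σ ∈ 𝓜.pathSpace)
    (n : ℕ) : 𝓜.backPoint x σ n ∈ 𝓜.vset (𝓜.init (σ 1)) :=
  backComp_mem hσ n (hx _)

theorem backComp_leftShift (σ : ℤ → E) (n : ℕ) (y : K) :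
    𝓜.backComp (leftShift σ) (n + 1) y = 𝓜.w (σ 1) (𝓜.backComp σ n y) := by
  induction n generalizing y with
  | zero => simp [backComp, leftShift, shiftBy]
  | succ n ih =>
    rw [backComp, ih, backComp]
    congr 3

theorem backPoint_leftShift (x : V → K) (σ : ℤ → E) (n : ℕ) :
    𝓜.backPoint x (leftShift σ) (n + 1) = 𝓜.w (σ 1) (𝓜.backPoint x σ n) := by
  rw [backPoint, backComp_leftShift, backPoint]
  congr 4
  simp only [leftShift, shiftBy]
  congr 1
  push_cast
  ring

theorem measurable_backPoint [MeasurableSpace E] [DiscreteMeasurableSpace E] (x : V → K) (n : ℕ) :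
    Measurable fun σ => 𝓜.backPoint x σ n :=
  (dependsOn_backPoint x n).measurable_of_Icc

section Topological

variable [TopologicalSpace K]

theorem mem_codingDomain_iff {x : V → K} {σ : ℤ → E} :
    σ ∈ 𝓜.codingDomain x ↔ ∀ j : ℤ, shiftBy j σ ∈ 𝓜.limitSet x := by
  simp only [codingDomain, Set.mem_iInter]
  constructor
  · intro h j
    obtain ⟨τ, hτ, rfl⟩ := h (-j)
    rwa [shiftBy_shiftBy, add_neg_cancel, shiftBy_zero]
  · intro h j
    exact ⟨shiftBy (-j) σ, h (-j), by rw [shiftBy_shiftBy, add_neg_cancel, shiftBy_zero]⟩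

theorem mem_limitSet_of_mem_codingDomain {x : V → K} {σ : ℤ → E} (h : σ ∈ 𝓜.codingDomain x) :
    σ ∈ 𝓜.limitSet x := by
  simpa [shiftBy_zero] using mem_codingDomain_iff.1 h 0

theorem tendsto_backPoint {x : V → K} {σ : ℤ → E} (h : σ ∈ 𝓜.limitSet x) :
    Tendsto (𝓜.backPoint x σ) atTop (𝓝 (𝓜.codingMap x σ)) := by
  rw [codingMap, dif_pos h.2]
  exact h.2.choose_spec

end Topological

section Metric

variable [MetricSpace K] {x : V → K}

theorem codingMap_mem (hopen : ∀ i, IsOpen (𝓜.vset i)) (hx : ∀ i, x i ∈ 𝓜.vset i) {σ : ℤ → E}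
    (h : σ ∈ 𝓜.codingDomain x) : 𝓜.codingMap x σ ∈ 𝓜.vset (𝓜.init (σ 1)) :=
  have hl := mem_limitSet_of_mem_codingDomain h
  (isClosed_vset hopen _).mem_of_tendsto (tendsto_backPoint hl)
    (Eventually.of_forall fun n => backPoint_mem hx hl.1 n)

/-- The approximating points satisfy this relation exactly, with one more step on the left. It
passes to the limit because these points and F σ lie in the vertex set on which w_{σ 1} is
continuous. -/
theorem codingMap_leftShift (hopen : ∀ i, IsOpen (𝓜.vset i))
    (hw : ∀ e, ContinuousOn (𝓜.w e) (𝓜.vset (𝓜.init e))) (hx : ∀ i, x i ∈ 𝓜.vset i) {σ : ℤ → E}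
    (h : σ ∈ 𝓜.codingDomain x) :
    𝓜.codingMap x (leftShift σ) = 𝓜.w (σ 1) (𝓜.codingMap x σ) := by
  have hl := mem_limitSet_of_mem_codingDomain h
  have h1 := (tendsto_add_atTop_iff_nat 1).2 (tendsto_backPoint (mem_codingDomain_iff.1 h 1))
  have h2 := (hw (σ 1) _ (codingMap_mem hopen hx h)).tendsto.comp
    (tendsto_nhdsWithin_iff.2 ⟨tendsto_backPoint hl,
      Eventually.of_forall fun n => backPoint_mem hx hl.1 n⟩)
  refine tendsto_nhds_unique h1 (h2.congr fun n => ?_)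
  exact (backPoint_leftShift x σ n).symm

variable [ProperSpace K] [BorelSpace K] [MeasurableSpace E] [DiscreteMeasurableSpace E]

theorem measurableSet_exists_tendsto_backPoint (x : V → K) :
    MeasurableSet {σ | ∃ y : K, Tendsto (𝓜.backPoint x σ) atTop (𝓝 y)} :=
  measurableSet_exists_tendsto (f := fun n σ => 𝓜.backPoint x σ n) (measurable_backPoint x)

theorem measurable_codingMap (x : V → K) : Measurable (𝓜.codingMap x) := by
  classical
  have hinit : Measurable fun σ : ℤ → E => x (𝓜.init (σ 0)) :=
    (Measurable.of_discrete (f := fun e => x (𝓜.init e))).comp (measurable_pi_apply 0)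
  refine measurable_of_tendsto_metrizable (f := fun n σ =>
    if ∃ y : K, Tendsto (𝓜.backPoint x σ) atTop (𝓝 y) then 𝓜.backPoint x σ n
      else x (𝓜.init (σ 0)))
    (fun n => (measurable_backPoint x n).ite (measurableSet_exists_tendsto_backPoint x) hinit) ?_
  refine tendsto_pi_nhds.2 fun σ => ?_
  by_cases h : ∃ y : K, Tendsto (𝓜.backPoint x σ) atTop (𝓝 y)
  · simp only [if_pos h]
    rw [codingMap, dif_pos h]
    exact h.choose_spec
  · simp only [if_neg h]
    rw [codingMap, dif_neg h]
    exact tendsto_const_nhds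

theorem measurableSet_limitSet (x : V → K) : MeasurableSet (𝓜.limitSet x) := by
  refine MeasurableSet.inter ?_ (measurableSet_exists_tendsto_backPoint x)
  simp only [pathSpace, Set.ofPred_forall]
  have hm : ∀ j : ℤ, Measurable fun σ : ℤ → E => (σ j, σ (j + 1)) := fun j =>
    (measurable_pi_apply j).prodMk (measurable_pi_apply (j + 1))
  exact MeasurableSet.iInter fun j => hm j (MeasurableSet.of_discrete
    (s := {q : E × E | 𝓜.term q.1 = 𝓜.init q.2}))

theorem measurableSet_codingDomain (x : V → K) : MeasurableSet (𝓜.codingDomain x) := by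
  have : 𝓜.codingDomain x = ⋂ j : ℤ, shiftBy j ⁻¹' 𝓜.limitSet x := by
    ext σ
    simp [mem_codingDomain_iff]
  rw [this]
  exact MeasurableSet.iInter fun j => measurable_shiftBy j (measurableSet_limitSet x)

/-- A function of the letter at `1` and the coding map is measurable. -/
theorem measurable_coding {φ : E → K → ℝ} (hφ : ∀ e, Measurable (φ e)) (x : V → K) :
    Measurable fun σ : ℤ → E => φ (σ 1) (𝓜.codingMap x σ) :=
  (measurable_from_prod_countable_right (f := fun q : E × K => φ q.1 q.2) hφ).comp
    ((measurable_pi_apply 1).prodMk (measurable_codingMap x))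

theorem isEnergyFunction_energy (x : V → K) : IsEnergyFunction (𝓜.energy x) := by
  classical
  constructor
  · exact Measurable.ite (measurableSet_codingDomain x)
      (measurable_coe_real_ereal.comp (measurable_coding
        (fun e => Real.measurable_log.comp (𝓜.p_measurable e)) x)) measurable_const
  · intro σ
    rw [energy]
    split_ifs
    · exact_mod_cast Real.log_nonpos (𝓜.p_nonneg _ _) (𝓜.p_le_one _ _)
    · exact bot_le

/-- The integral of the energy function for a measure on the coding domain. -/
theorem energyIntegral_energy {Θ : Measure (ℤ → E)} [IsProbabilityMeasure Θ]
    (hopen : ∀ i, IsOpen (𝓜.vset i)) (hx : ∀ i, x i ∈ 𝓜.vset i)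
    (hpos : ∃ δ : ℝ, 0 < δ ∧ ∀ e, ∀ y ∈ 𝓜.vset (𝓜.init e), δ ≤ 𝓜.p e y)
    (hY : ∀ᵐ σ ∂Θ, σ ∈ 𝓜.codingDomain x) :
    Integrable (fun σ => Real.log (𝓜.p (σ 1) (𝓜.codingMap x σ))) Θ ∧
    energyIntegral Θ (𝓜.energy x) =
      ((∫ σ, Real.log (𝓜.p (σ 1) (𝓜.codingMap x σ)) ∂Θ : ℝ) : EReal) := by
  obtain ⟨δ, hδ, hδp⟩ := hpos
  have hint : Integrable (fun σ => Real.log (𝓜.p (σ 1) (𝓜.codingMap x σ))) Θ := by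
    refine Integrable.of_bound (measurable_coding (fun e => Real.measurable_log.comp
      (𝓜.p_measurable e)) x).aestronglyMeasurable (-Real.log δ) ?_
    filter_upwards [hY] with σ hσ
    rw [Real.norm_eq_abs, abs_of_nonpos (Real.log_nonpos (𝓜.p_nonneg _ _) (𝓜.p_le_one _ _))]
    exact neg_le_neg (Real.log_le_log hδ (hδp _ _ (codingMap_mem hopen hx hσ)))
  refine ⟨hint, ?_⟩
  have h1 : ∫⁻ σ, (-𝓜.energy x σ).toENNReal ∂Θ =
      ENNReal.ofReal (∫ σ, -Real.log (𝓜.p (σ 1) (𝓜.codingMap x σ)) ∂Θ) := by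
    rw [ofReal_integral_eq_lintegral_ofReal (f := fun σ =>
      -Real.log (𝓜.p (σ 1) (𝓜.codingMap x σ))) hint.neg (Eventually.of_forall fun σ =>
      neg_nonneg.2 (Real.log_nonpos (𝓜.p_nonneg _ _) (𝓜.p_le_one _ _)))]
    refine lintegral_congr_ae ?_
    filter_upwards [hY] with σ hσ
    rw [energy, if_pos hσ, ← EReal.coe_neg, EReal.toENNReal_of_ne_top (EReal.coe_ne_top _),
      EReal.toReal_coe]
  rw [energyIntegral, h1, EReal.coe_ennreal_ofReal, max_eq_left, integral_neg]
  · simp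
  · exact integral_nonneg fun σ =>
      neg_nonneg.2 (Real.log_nonpos (𝓜.p_nonneg _ _) (𝓜.p_le_one _ _))

/-- A measure for which the energy function has a finite integral lives on the coding domain. -/
theorem ae_mem_codingDomain {Θ : Measure (ℤ → E)} (h : energyIntegral Θ (𝓜.energy x) ≠ ⊥) :
    ∀ᵐ σ ∂Θ, σ ∈ 𝓜.codingDomain x := by
  have hfin : ∫⁻ σ, (-𝓜.energy x σ).toENNReal ∂Θ ≠ ∞ := fun htop => h (by
    rw [energyIntegral, htop]; rfl)
  have hm : Measurable fun σ => (-𝓜.energy x σ).toENNReal :=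
    (isEnergyFunction_energy x).1.neg.ereal_toENNReal
  filter_upwards [ae_lt_top hm hfin] with σ hσ
  by_contra hcon
  rw [energy, if_neg hcon] at hσ
  simp at hσ

end Metric

end Coding

/-! ## Sums over words -/

section PathSums

variable {K V E : Type*} [MeasurableSpace K] [Fintype E] (𝓜 : MarkovSystem K V E)

/-- The Markov property at the first step. With Φ arbitrary, it serves as the recursion for all the
sums over words below. -/
theorem sum_pathProb_succ (n : ℕ) (x : K) (Φ : List E → ℝ) :
    ∑ v : Fin (n + 1) → E, 𝓜.pathProb (List.ofFn v) x * Φ (List.ofFn v) =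
      ∑ e, 𝓜.p e x *
        ∑ v : Fin n → E, 𝓜.pathProb (List.ofFn v) (𝓜.w e x) * Φ (e :: List.ofFn v) := by
  rw [← (Fin.consEquiv fun _ : Fin (n + 1) => E).sum_comp, Fintype.sum_prod_type]
  refine Finset.sum_congr rfl fun e _ => ?_
  rw [Finset.mul_sum]
  refine Finset.sum_congr rfl fun v _ => ?_
  simp only [Fin.consEquiv, Equiv.coe_fn_mk, List.ofFn_cons, pathProb, mul_assoc]

theorem sum_pathProb (n : ℕ) (x : K) : ∑ v : Fin n → E, 𝓜.pathProb (List.ofFn v) x = 1 := by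
  induction n generalizing x with
  | zero => simp [pathProb]
  | succ n ih =>
    have := 𝓜.sum_pathProb_succ n x fun _ => 1
    simp only [mul_one, ih, 𝓜.p_sum] at this
    exact this

theorem markovOp_iterate_bounded {g : K → ℝ} (hg : Measurable g) {B : ℝ} (hB : ∀ y, |g y| ≤ B)
    (n : ℕ) : Measurable (𝓜.markovOp^[n] g) ∧ ∀ y, |𝓜.markovOp^[n] g y| ≤ B := by
  induction n with
  | zero => exact ⟨hg, hB⟩
  | succ n ih =>
    rw [Function.iterate_succ_apply']
    exact ⟨𝓜.measurable_markovOp ih.1, fun y => 𝓜.abs_sum_p_mul_le fun e => ih.2 _⟩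

theorem integral_markovOp_iterate_eq {μ : Measure K} (hμ : 𝓜.IsInvariant μ) {g : K → ℝ}
    (hg : Measurable g) {B : ℝ} (hB : ∀ y, |g y| ≤ B) (n : ℕ) :
    ∫ y, 𝓜.markovOp^[n] g y ∂μ = ∫ y, g y ∂μ := by
  induction n with
  | zero => rfl
  | succ n ih =>
    obtain ⟨h1, h2⟩ := 𝓜.markovOp_iterate_bounded hg hB n
    rw [Function.iterate_succ_apply', ← ih]
    exact hμ.2 _ h1 ⟨B, h2⟩

/-- The value of `φ` for the last letter `e` of a word at the image of a point under the maps of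
the preceding letters. -/
def lastStep (φ : E → K → ℝ) : List E → K → ℝ
  | [], _ => 0
  | [e], y => φ e y
  | e :: e' :: l, y => lastStep φ (e' :: l) (𝓜.w e y)

theorem lastStep_cons (φ : E → K → ℝ) (e : E) {n : ℕ} (v : Fin (n + 1) → E) (y : K) :
    𝓜.lastStep φ (e :: List.ofFn v) y = 𝓜.lastStep φ (List.ofFn v) (𝓜.w e y) := by
  rw [List.ofFn_succ]
  rfl

theorem measurable_lastStep {φ : E → K → ℝ} (hφ : ∀ e, Measurable (φ e)) {n : ℕ}
    (v : Fin n → E) : Measurable (𝓜.lastStep φ (List.ofFn v)) := by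
  induction n with
  | zero => simp [lastStep]
  | succ n ih =>
    rw [List.ofFn_succ]
    cases n with
    | zero => exact hφ _
    | succ n =>
      simp_rw [funext (𝓜.lastStep_cons φ (v 0) fun i : Fin (n + 1) => v i.succ)]
      exact (ih _).comp (𝓜.w_measurable _)

theorem abs_lastStep_le {φ : E → K → ℝ} {B : ℝ} (hB0 : 0 ≤ B) (hB : ∀ e y, |φ e y| ≤ B) {n : ℕ}
    (v : Fin n → E) (y : K) : |𝓜.lastStep φ (List.ofFn v) y| ≤ B := by
  induction n generalizing y with
  | zero => simpa [lastStep] using hB0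
  | succ n ih =>
    rw [List.ofFn_succ]
    cases n with
    | zero => exact hB _ _
    | succ n =>
      rw [𝓜.lastStep_cons]
      exact ih _ _

theorem sum_pathProb_lastStep (φ : E → K → ℝ) (n : ℕ) (y : K) :
    ∑ v : Fin (n + 1) → E, 𝓜.pathProb (List.ofFn v) y * 𝓜.lastStep φ (List.ofFn v) y =
      𝓜.markovOp^[n] (fun z => ∑ e, 𝓜.p e z * φ e z) y := by
  induction n generalizing y with
  | zero =>
    rw [𝓜.sum_pathProb_succ 0 y fun l => 𝓜.lastStep φ l y]
    simp [pathProb, lastStep]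
  | succ n ih =>
    rw [𝓜.sum_pathProb_succ (n + 1) y fun l => 𝓜.lastStep φ l y, Function.iterate_succ_apply',
      markovOp]
    refine Finset.sum_congr rfl fun e _ => ?_
    simp only [𝓜.lastStep_cons, ih]

/-- A coupling argument: y and z follow the same random word, drawn with the probabilities of y. A
letter of positive probability starts at their common vertex and sends both into one vertex set, so
the argument repeats; each letter before the last contributes a factor a to the mean of ρ. -/
theorem sum_pathProb_abs_lastStep_sub_le {φ : E → K → ℝ} {ρ : K → K → ℝ} {a c C : ℝ} (hC : 0 ≤ C)
    (ha : 0 ≤ a) (hρ : ∀ i, ∀ y ∈ 𝓜.vset i, ∀ z ∈ 𝓜.vset i,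
      ∑ e, 𝓜.p e y * ρ (𝓜.w e y) (𝓜.w e z) ≤ a * ρ y z)
    (hφ : ∀ i, ∀ y ∈ 𝓜.vset i, ∀ z ∈ 𝓜.vset i,
      ∑ e, 𝓜.p e y * |φ e y - φ e z| ≤ c + C * ρ y z) (n : ℕ) {i : V} {y z : K}
    (hy : y ∈ 𝓜.vset i) (hz : z ∈ 𝓜.vset i) :
    ∑ v : Fin (n + 1) → E, 𝓜.pathProb (List.ofFn v) y *
      |𝓜.lastStep φ (List.ofFn v) y - 𝓜.lastStep φ (List.ofFn v) z| ≤ c + C * a ^ n * ρ y z := by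
  induction n generalizing i y z with
  | zero =>
    rw [𝓜.sum_pathProb_succ 0 y fun l => |𝓜.lastStep φ l y - 𝓜.lastStep φ l z|]
    simpa [pathProb, lastStep] using hφ i y hy z hz
  | succ n ih =>
    rw [𝓜.sum_pathProb_succ (n + 1) y fun l => |𝓜.lastStep φ l y - 𝓜.lastStep φ l z|]
    simp only [𝓜.lastStep_cons]
    calc _ ≤ ∑ e, (𝓜.p e y * c + C * a ^ n * (𝓜.p e y * ρ (𝓜.w e y) (𝓜.w e z))) := by
          refine Finset.sum_le_sum fun e _ => ?_
          rcases eq_or_ne (𝓜.p e y) 0 with h0 | h0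
          · simp [h0]
          · have hie := 𝓜.vset_eq_of_mem hy (𝓜.mem_vset_of_p_ne_zero h0)
            subst hie
            have := mul_le_mul_of_nonneg_left (ih (𝓜.w_mapsTo e hy) (𝓜.w_mapsTo e hz))
              (𝓜.p_nonneg e y)
            linarith
      _ = c + C * a ^ n * ∑ e, 𝓜.p e y * ρ (𝓜.w e y) (𝓜.w e z) := by
          rw [Finset.sum_add_distrib, ← Finset.sum_mul, 𝓜.p_sum, one_mul, ← Finset.mul_sum]
      _ ≤ c + C * a ^ n * (a * ρ y z) := by
          have := mul_le_mul_of_nonneg_left (hρ i y hy z hz) (mul_nonneg hC (pow_nonneg ha n))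
          linarith
      _ = _ := by ring

/-- The word occupies the places -k, …, 1: its first k + 1 letters supply the maps of `backComp σ
k`, and the letter at 1 goes into φ. -/
theorem lastStep_wordAt (φ : E → K → ℝ) (σ : ℤ → E) (k : ℕ) (y : K) :
    𝓜.lastStep φ (List.ofFn (wordAt (-(k : ℤ)) (k + 2) σ)) y = φ (σ 1) (𝓜.backComp σ k y) := by
  induction k generalizing y with
  | zero => simp [wordAt, lastStep, backComp]
  | succ k ih =>
    have : List.ofFn (wordAt (-((k + 1 : ℕ) : ℤ)) (k + 1 + 2) σ) =
        σ (-((k : ℤ) + 1)) :: List.ofFn (wordAt (-(k : ℤ)) (k + 2) σ) := by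
      rw [List.ofFn_succ]
      refine congrArg₂ List.cons (by simp [wordAt]) (congrArg List.ofFn (funext fun j => ?_))
      simp only [wordAt, Fin.val_succ]
      congr 1
      push_cast
      ring
    rw [this, lastStep_cons, ih, backComp]

theorem init_eq_of_pathProb_ne_zero {n : ℕ} {v : Fin (n + 1) → E} {y : K} {i : V}
    (h : 𝓜.pathProb (List.ofFn v) y ≠ 0) (hy : y ∈ 𝓜.vset i) : 𝓜.init (v 0) = i := by
  rw [List.ofFn_succ, pathProb] at h
  exact 𝓜.vset_eq_of_mem (𝓜.mem_vset_of_p_ne_zero (left_ne_zero_of_mul h)) hy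

theorem integrable_pathProb (μ : Measure K) [IsFiniteMeasure μ] (l : List E) :
    Integrable (𝓜.pathProb l) μ :=
  Integrable.of_bound (𝓜.pathProb_measurable l).aestronglyMeasurable 1
    (Eventually.of_forall fun y => by
      rw [Real.norm_eq_abs, abs_of_nonneg (𝓜.pathProb_nonneg l y)]
      exact 𝓜.pathProb_le_one l y)

end PathSums

/-! ## The generalized Markov measure -/

theorem codeCylinder_ofFn {E : Type*} (m : ℤ) {n : ℕ} (v : Fin n → E) :
    codeCylinder m (List.ofFn v) = wordAt m n ⁻¹' {v} := by
  ext σ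
  simp only [codeCylinder, Set.mem_ofPred_eq, Set.mem_preimage, Set.mem_singleton_iff, funext_iff,
    wordAt, List.length_ofFn, List.getElem_ofFn]
  exact ⟨fun h j => h j j.2, fun h k hk => h ⟨k, hk⟩⟩

section GeneralizedMarkovMeasure

variable {K V E : Type*} [MeasurableSpace K] [Fintype E] {𝓜 : MarkovSystem K V E}
  [MeasurableSpace E] {μ : Measure K} {M : Measure (ℤ → E)}

theorem IsGeneralizedMarkovMeasure.isProbabilityMeasure [IsProbabilityMeasure μ]
    (hM : 𝓜.IsGeneralizedMarkovMeasure μ M) : IsProbabilityMeasure M := by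
  constructor
  have := hM 0 []
  simpa [codeCylinder, pathProb] using this

theorem IsGeneralizedMarkovMeasure.real_wordAt (hM : 𝓜.IsGeneralizedMarkovMeasure μ M) (m : ℤ)
    {n : ℕ} (v : Fin n → E) :
    M.real (wordAt m n ⁻¹' {v}) = ∫ y, 𝓜.pathProb (List.ofFn v) y ∂μ := by
  rw [Measure.real, ← codeCylinder_ofFn, hM,
    ENNReal.toReal_ofReal (integral_nonneg fun y => 𝓜.pathProb_nonneg _ y)]

variable [DiscreteMeasurableSpace E]

theorem IsGeneralizedMarkovMeasure.eq_of_wordAt [IsProbabilityMeasure μ]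
    (hM : 𝓜.IsGeneralizedMarkovMeasure μ M) {Θ : Measure (ℤ → E)} [IsFiniteMeasure Θ]
    (h : ∀ (m : ℤ) (n : ℕ) (v : Fin n → E),
      Θ.real (wordAt m n ⁻¹' {v}) = ∫ y, 𝓜.pathProb (List.ofFn v) y ∂μ) : Θ = M := by
  have := hM.isProbabilityMeasure
  refine ext_of_wordAt fun m n v => ?_
  rw [← ofReal_measureReal, ← ofReal_measureReal, h, hM.real_wordAt]

theorem IsGeneralizedMarkovMeasure.isInvariantProb [IsProbabilityMeasure μ]
    (hM : 𝓜.IsGeneralizedMarkovMeasure μ M) : IsInvariantProb leftShift M := by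
  have := hM.isProbabilityMeasure
  have hm : Measurable (leftShift : (ℤ → E) → ℤ → E) := measurable_shiftBy 1
  have := Measure.isProbabilityMeasure_map (μ := M) hm.aemeasurable
  refine ⟨inferInstance, hm, hM.eq_of_wordAt fun m n v => ?_⟩
  rw [map_measureReal_apply hm (measurable_wordAt m n (MeasurableSet.singleton v)),
    ← hM.real_wordAt (m + 1) v]
  congr 1
  ext σ
  simp only [Set.mem_preimage, Set.mem_singleton_iff, funext_iff, wordAt, leftShift, shiftBy,
    add_right_comm m]

theorem IsGeneralizedMarkovMeasure.integral_wordAt [IsProbabilityMeasure μ]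
    (hM : 𝓜.IsGeneralizedMarkovMeasure μ M) (m : ℤ) {n : ℕ} (Ψ : (Fin n → E) → ℝ) :
    ∫ σ, Ψ (wordAt m n σ) ∂M = ∑ v, (∫ y, 𝓜.pathProb (List.ofFn v) y ∂μ) * Ψ v := by
  have := hM.isProbabilityMeasure
  have := Measure.isProbabilityMeasure_map (μ := M) (measurable_wordAt (E := E) m n).aemeasurable
  rw [← integral_map (measurable_wordAt m n).aemeasurable
    (measurable_of_finite Ψ).aestronglyMeasurable, integral_fintype .of_finite]
  refine Finset.sum_congr rfl fun v _ => ?_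
  rw [map_measureReal_apply (measurable_wordAt m n) (MeasurableSet.singleton v),
    hM.real_wordAt, smul_eq_mul]

end GeneralizedMarkovMeasure

/-! ### The image of the generalized Markov measure under the coding map -/

section Image

variable {K V E : Type*} [MetricSpace K] [MeasurableSpace K] [Fintype E] {𝓜 : MarkovSystem K V E}
  {φ : E → K → ℝ} {B : ℝ}

/-- At distances below the modulus η_e, uniform continuity gives ε; at larger distances the trivial
bound 2B is at most (2B / η_e) d(y, z). This puts φ into the form required by the coupling estimate.
-/
theorem exists_sum_abs_sub_le (hB : ∀ e y, |φ e y| ≤ B)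
    (huc : ∀ e, UniformContinuousOn (φ e) (𝓜.vset (𝓜.init e))) {ε : ℝ} (hε : 0 < ε) :
    ∃ C, 0 ≤ C ∧ ∀ i, ∀ y ∈ 𝓜.vset i, ∀ z ∈ 𝓜.vset i,
      ∑ e, 𝓜.p e y * |φ e y - φ e z| ≤ ε + C * dist y z := by
  have hη : ∀ e, ∃ η > 0, ∀ y ∈ 𝓜.vset (𝓜.init e), ∀ z ∈ 𝓜.vset (𝓜.init e), dist y z < η →
      |φ e y - φ e z| < ε := fun e => by
    simpa only [Real.dist_eq] using Metric.uniformContinuousOn_iff.1 (huc e) ε hε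
  choose η hη0 hη using hη
  rcases isEmpty_or_nonempty E with hE | hE
  · exact ⟨0, le_rfl, fun i y _ z _ => by simpa using hε.le⟩
  have hB0 : 0 ≤ B := by
    obtain ⟨e⟩ := hE
    obtain ⟨y, -⟩ := 𝓜.vset_nonempty (𝓜.init e)
    exact (abs_nonneg _).trans (hB e y)
  have hC0 : ∀ e, 0 ≤ 2 * B / η e := fun e => div_nonneg (by linarith) (hη0 e).le
  refine ⟨∑ e, 2 * B / η e, Finset.sum_nonneg fun e _ => hC0 e, fun i y hy z hz =>
    𝓜.sum_p_mul_le fun e he => ?_⟩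
  obtain rfl := 𝓜.vset_eq_of_mem hy (𝓜.mem_vset_of_p_ne_zero he)
  rcases lt_or_ge (dist y z) (η e) with h | h
  · have := hη e y hy z hz h
    have : 0 ≤ (∑ e, 2 * B / η e) * dist y z :=
      mul_nonneg (Finset.sum_nonneg fun e _ => hC0 e) dist_nonneg
    linarith
  · calc |φ e y - φ e z| ≤ |φ e y| + |φ e z| := abs_sub _ _
      _ ≤ 2 * B := by linarith [hB e y, hB e z]
      _ = 2 * B / η e * η e := by field_simp [(hη0 e).ne']
      _ ≤ 2 * B / η e * dist y z := mul_le_mul_of_nonneg_left h (hC0 e)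
      _ ≤ (∑ e, 2 * B / η e) * dist y z := mul_le_mul_of_nonneg_right
          (Finset.single_le_sum (f := fun e => 2 * B / η e) (fun e _ => hC0 e)
            (Finset.mem_univ e)) dist_nonneg
      _ ≤ _ := by linarith

variable [MeasurableSpace E] [DiscreteMeasurableSpace E]
  {μ : Measure K} {M : Measure (ℤ → E)} {x : V → K}

/-- Under the generalized Markov measure, the letter at `1` and the coding map are distributed as
the first letter and the starting point of the Markov process with initial distribution `μ`. -/
theorem IsGeneralizedMarkovMeasure.integral_coding
    (hM : 𝓜.IsGeneralizedMarkovMeasure μ M) (hμ : 𝓜.IsInvariant μ) (hcontr : 𝓜.IsContractive)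
    (hopen : ∀ i, IsOpen (𝓜.vset i)) (hx : ∀ i, x i ∈ 𝓜.vset i)
    (hY : ∀ᵐ σ ∂M, σ ∈ 𝓜.codingDomain x) (hφ : ∀ e, Measurable (φ e))
    (hB : ∀ e y, |φ e y| ≤ B) (huc : ∀ e, UniformContinuousOn (φ e) (𝓜.vset (𝓜.init e))) :
    ∫ σ, φ (σ 1) (𝓜.codingMap x σ) ∂M = ∫ y, ∑ e, 𝓜.p e y * φ e y ∂μ := by
  have := hμ.1
  have := hM.isProbabilityMeasure
  obtain ⟨a, ha0, ha1, ha⟩ := hcontr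
  obtain ⟨σ₀⟩ := M.nonempty_of_neZero
  have hB0 : 0 ≤ B := (abs_nonneg _).trans (hB (σ₀ 0) (x (𝓜.init (σ₀ 0))))
  let Ψ : ∀ k, (Fin (k + 2) → E) → ℝ := fun k v =>
    𝓜.lastStep φ (List.ofFn v) (x (𝓜.init (v 0)))
  have hΨ : ∀ k σ, φ (σ 1) (𝓜.backPoint x σ k) = Ψ k (wordAt (-(k : ℤ)) (k + 2) σ) := fun k σ => by
    simp only [Ψ, lastStep_wordAt, backPoint]
    simp [wordAt]
  have hlim1 : Tendsto (fun k => ∫ σ, φ (σ 1) (𝓜.backPoint x σ k) ∂M) atTop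
      (𝓝 (∫ σ, φ (σ 1) (𝓜.codingMap x σ) ∂M)) := by
    refine tendsto_integral_of_dominated_convergence (fun _ => B) (fun k => ?_) (integrable_const _)
      (fun k => Eventually.of_forall fun σ => hB _ _) ?_
    · simp only [hΨ]
      exact ((measurable_of_finite (Ψ k)).comp (measurable_wordAt _ _)).aestronglyMeasurable
    · filter_upwards [hY] with σ hσ
      have hl := mem_limitSet_of_mem_codingDomain hσ
      exact ((huc (σ 1)).continuousOn _ (codingMap_mem hopen hx hσ)).tendsto.comp
        (tendsto_nhdsWithin_iff.2 ⟨tendsto_backPoint hl,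
          Eventually.of_forall fun n => backPoint_mem hx hl.1 n⟩)
  -- The mean discrepancy between starting a random word at y and starting it at the base point of
  -- the initial vertex of the word.
  let D : ℕ → K → ℝ := fun k y => ∑ v : Fin (k + 2) → E, 𝓜.pathProb (List.ofFn v) y *
    |𝓜.lastStep φ (List.ofFn v) y - Ψ k v|
  have hD0 : ∀ k y, 0 ≤ D k y := fun k y => Finset.sum_nonneg fun v _ =>
    mul_nonneg (𝓜.pathProb_nonneg _ _) (abs_nonneg _)
  have hDm : ∀ k, Measurable (D k) := fun k => Finset.measurable_sum _ fun v _ =>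
    (𝓜.pathProb_measurable _).mul
      (continuous_abs.measurable.comp ((𝓜.measurable_lastStep hφ v).sub_const _))
  have hDB : ∀ k y, D k y ≤ 2 * B := fun k y => by
    calc D k y ≤ ∑ v : Fin (k + 2) → E, 𝓜.pathProb (List.ofFn v) y * (2 * B) :=
          Finset.sum_le_sum fun v _ => mul_le_mul_of_nonneg_left
            ((abs_sub _ _).trans (by
              linarith [𝓜.abs_lastStep_le hB0 hB v y,
                𝓜.abs_lastStep_le hB0 hB v (x (𝓜.init (v 0)))])) (𝓜.pathProb_nonneg _ _)
      _ = 2 * B := by rw [← Finset.sum_mul, 𝓜.sum_pathProb, one_mul]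
  have hDlim : ∀ y, Tendsto (fun k => D k y) atTop (𝓝 0) := fun y => by
    obtain ⟨i, hy⟩ := 𝓜.exists_mem_vset y
    refine Metric.tendsto_atTop.2 fun ε hε => ?_
    obtain ⟨C, hC0, hC⟩ := exists_sum_abs_sub_le (𝓜 := 𝓜) hB huc (half_pos hε)
    have hle : ∀ k, D k y ≤ ε / 2 + C * a ^ (k + 1) * dist y (x i) := fun k => by
      refine le_of_eq_of_le (Finset.sum_congr rfl fun v _ => ?_)
        (𝓜.sum_pathProb_abs_lastStep_sub_le hC0 ha0.le ha hC (k + 1) hy (hx i))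
      -- A word of positive probability from y starts at the vertex of y, so its base point is x i.
      by_cases h : 𝓜.pathProb (List.ofFn v) y = 0
      · rw [h, zero_mul, zero_mul]
      · simp only [Ψ, 𝓜.init_eq_of_pathProb_ne_zero h hy]
    have hpow : Tendsto (fun k => C * a ^ (k + 1) * dist y (x i)) atTop (𝓝 0) := by
      have := (((tendsto_add_atTop_iff_nat 1).2
        (tendsto_pow_atTop_nhds_zero_of_lt_one ha0.le ha1)).const_mul C).mul_const (dist y (x i))
      simpa using this
    obtain ⟨k₀, hk₀⟩ := eventually_atTop.1 (hpow.eventually_lt_const (half_pos hε))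
    refine ⟨k₀, fun k hk => ?_⟩
    rw [Real.dist_eq, sub_zero, abs_of_nonneg (hD0 k y)]
    linarith [hle k, hk₀ k hk]
  have hDint : Tendsto (fun k => ∫ y, D k y ∂μ) atTop (𝓝 0) := by
    have := tendsto_integral_of_dominated_convergence (μ := μ) (F := D) (f := fun _ => 0)
      (fun _ => 2 * B) (fun k => (hDm k).aestronglyMeasurable) (integrable_const _)
      (fun k => Eventually.of_forall fun y => by
        rw [Real.norm_eq_abs, abs_of_nonneg (hD0 k y)]; exact hDB k y)
      (Eventually.of_forall hDlim)
    simpa using this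
  have hgm : Measurable fun y => ∑ e, 𝓜.p e y * φ e y :=
    Finset.measurable_sum _ fun e _ => (𝓜.p_measurable e).mul (hφ e)
  have hprodint : ∀ (k : ℕ) (v : Fin (k + 2) → E), Integrable (fun y =>
      𝓜.pathProb (List.ofFn v) y * 𝓜.lastStep φ (List.ofFn v) y) μ := fun k v =>
    (𝓜.integrable_pathProb μ _).mul_bdd (c := B) (𝓜.measurable_lastStep hφ v).aestronglyMeasurable
      (Eventually.of_forall fun y => 𝓜.abs_lastStep_le hB0 hB v y)
  have hdiff : ∀ k, ‖(∫ y, ∑ e, 𝓜.p e y * φ e y ∂μ) - ∫ σ, φ (σ 1) (𝓜.backPoint x σ k) ∂M‖ ≤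
      ∫ y, D k y ∂μ := fun k => by
    -- Invariance of μ allows k + 1 steps of the process before the letter in φ is drawn, as many as
    -- `backPoint x σ k` makes.
    have h1 : ∫ y, ∑ e, 𝓜.p e y * φ e y ∂μ = ∑ v : Fin (k + 2) → E,
        ∫ y, 𝓜.pathProb (List.ofFn v) y * 𝓜.lastStep φ (List.ofFn v) y ∂μ := by
      rw [← 𝓜.integral_markovOp_iterate_eq hμ hgm (fun y => 𝓜.abs_sum_p_mul_le fun e => hB e y)
        (k + 1), ← integral_finsetSum _ fun v _ => hprodint k v]
      simp only [𝓜.sum_pathProb_lastStep]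
    have h2 : ∫ σ, φ (σ 1) (𝓜.backPoint x σ k) ∂M = ∑ v : Fin (k + 2) → E,
        ∫ y, 𝓜.pathProb (List.ofFn v) y * Ψ k v ∂μ := by
      simp only [hΨ]
      rw [hM.integral_wordAt]
      simp only [integral_mul_const]
    rw [h1, h2, ← Finset.sum_sub_distrib]
    simp_rw [← integral_sub (hprodint k _) ((𝓜.integrable_pathProb μ _).mul_const _), ← mul_sub]
    rw [← integral_finsetSum]
    · refine norm_integral_le_of_norm_le (Integrable.of_bound (hDm k).aestronglyMeasurable (2 * B)
        (Eventually.of_forall fun y => by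
          rw [Real.norm_eq_abs, abs_of_nonneg (hD0 k y)]; exact hDB k y))
        (Eventually.of_forall fun y => ?_)
      refine (norm_sum_le _ _).trans_eq (Finset.sum_congr rfl fun v _ => ?_)
      rw [norm_mul, Real.norm_eq_abs, Real.norm_eq_abs, abs_of_nonneg (𝓜.pathProb_nonneg _ _)]
    · intro v _
      simp_rw [mul_sub]
      exact (hprodint k v).sub ((𝓜.integrable_pathProb μ _).mul_const _)
  have hlim2 := squeeze_zero_norm hdiff hDint
  have hlim3 := hlim1.const_sub (∫ y, ∑ e, 𝓜.p e y * φ e y ∂μ)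
  linarith [tendsto_nhds_unique hlim2 hlim3]

/-- The coding map sends the generalized Markov measure to the invariant measure. -/
theorem IsGeneralizedMarkovMeasure.map_codingMap [ProperSpace K] [BorelSpace K]
    (hM : 𝓜.IsGeneralizedMarkovMeasure μ M) (hμ : 𝓜.IsInvariant μ) (hcontr : 𝓜.IsContractive)
    (hopen : ∀ i, IsOpen (𝓜.vset i)) (hx : ∀ i, x i ∈ 𝓜.vset i)
    (hY : ∀ᵐ σ ∂M, σ ∈ 𝓜.codingDomain x) : M.map (𝓜.codingMap x) = μ := by
  have := hμ.1
  have := hM.isProbabilityMeasure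
  have hFm := measurable_codingMap (𝓜 := 𝓜) x
  have := Measure.isProbabilityMeasure_map (μ := M) hFm.aemeasurable
  have key : ∀ f : K → ℝ, Continuous f → UniformContinuous f → (∀ y, |f y| ≤ 1) →
      ∫ y, f y ∂(M.map (𝓜.codingMap x)) = ∫ y, f y ∂μ := fun f hc huc hf => by
    rw [integral_map hFm.aemeasurable hc.measurable.aestronglyMeasurable,
      hM.integral_coding (φ := fun _ => f) hμ hcontr hopen hx hY (fun _ => hc.measurable)
        (fun _ => hf) fun _ => huc.uniformContinuousOn]
    simp only [← Finset.sum_mul, 𝓜.p_sum, one_mul]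
  -- Indicators of closed sets are limits of thickened indicators, which are Lipschitz and so within
  -- the reach of `key`.
  refine ext_of_generate_finite _ (BorelSpace.measurable_eq.trans borel_eq_generateFrom_isClosed)
    isPiSystem_isClosed (fun F hF => ?_) (by simp)
  have hF' : IsClosed F := hF
  have hpos : ∀ n : ℕ, (0 : ℝ) < 1 / ((n : ℝ) + 1) := fun n => by positivity
  have hlim := fun (ν : Measure K) [IsProbabilityMeasure ν] =>
    tendsto_integral_thickenedIndicator_of_isClosed ν hF' hpos
      tendsto_one_div_add_atTop_nhds_zero_nat
  have heq := tendsto_nhds_unique (hlim (M.map (𝓜.codingMap x))) ((hlim μ).congr fun n => ?_)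
  · rw [← ofReal_measureReal, ← ofReal_measureReal, heq]
  · have hl := NNReal.isometry_coe.lipschitz.comp (lipschitzWith_thickenedIndicator (hpos n) F)
    exact (key _ hl.continuous hl.uniformContinuous fun y => by
      rw [Function.comp_apply, abs_of_nonneg (NNReal.coe_nonneg _)]
      exact_mod_cast thickenedIndicator_le_one (hpos n) F y).symm

end Image

/-! ## A lower bound for the entropy of the generalized Markov measure -/

section LowerBound

variable {K V E : Type*} [MeasurableSpace K] [Fintype E] {𝓜 : MarkovSystem K V E}

/-- The chain rule: the entropy of the first letter plus the mean entropy of the remaining word. -/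
theorem sum_negMulLog_pathProb_succ (n : ℕ) (y : K) :
    ∑ v : Fin (n + 1) → E, Real.negMulLog (𝓜.pathProb (List.ofFn v) y) =
      ∑ e, Real.negMulLog (𝓜.p e y) +
        𝓜.markovOp (fun z => ∑ v : Fin n → E, Real.negMulLog (𝓜.pathProb (List.ofFn v) z)) y := by
  rw [← (Fin.consEquiv fun _ : Fin (n + 1) => E).sum_comp, Fintype.sum_prod_type, markovOp,
    ← Finset.sum_add_distrib]
  refine Finset.sum_congr rfl fun e _ => ?_
  simp only [Fin.consEquiv, Equiv.coe_fn_mk, List.ofFn_cons, pathProb, Real.negMulLog_mul]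
  rw [Finset.sum_add_distrib, ← Finset.sum_mul, 𝓜.sum_pathProb, one_mul, Finset.mul_sum]

theorem abs_negMulLog_le_one {t : ℝ} (h0 : 0 ≤ t) (h1 : t ≤ 1) : |Real.negMulLog t| ≤ 1 := by
  rw [abs_of_nonneg (Real.negMulLog_nonneg h0 h1)]
  linarith [Real.negMulLog_le_one_sub_self h0]

theorem integrable_negMulLog_pathProb (μ : Measure K) [IsFiniteMeasure μ] (l : List E) :
    Integrable (fun y => Real.negMulLog (𝓜.pathProb l y)) μ :=
  Integrable.of_bound (Real.continuous_negMulLog.measurable.comp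
    (𝓜.pathProb_measurable l)).aestronglyMeasurable 1 (Eventually.of_forall fun y =>
      abs_negMulLog_le_one (𝓜.pathProb_nonneg l y) (𝓜.pathProb_le_one l y))

theorem integrable_negMulLog_p (μ : Measure K) [IsFiniteMeasure μ] (e : E) :
    Integrable (fun y => Real.negMulLog (𝓜.p e y)) μ :=
  Integrable.of_bound (Real.continuous_negMulLog.measurable.comp
    (𝓜.p_measurable e)).aestronglyMeasurable 1 (Eventually.of_forall fun y =>
      abs_negMulLog_le_one (𝓜.p_nonneg e y) (𝓜.p_le_one e y))

theorem integral_sum_negMulLog_pathProb {μ : Measure K} (hμ : 𝓜.IsInvariant μ) (n : ℕ) :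
    ∫ y, ∑ v : Fin n → E, Real.negMulLog (𝓜.pathProb (List.ofFn v) y) ∂μ =
      n * ∫ y, ∑ e, Real.negMulLog (𝓜.p e y) ∂μ := by
  have := hμ.1
  induction n with
  | zero => simp [pathProb]
  | succ n ih =>
    have hm : Measurable fun z => ∑ v : Fin n → E, Real.negMulLog (𝓜.pathProb (List.ofFn v) z) :=
      Finset.measurable_sum _ fun v _ =>
        Real.continuous_negMulLog.measurable.comp (𝓜.pathProb_measurable _)
    have hb : ∀ z, |∑ v : Fin n → E, Real.negMulLog (𝓜.pathProb (List.ofFn v) z)| ≤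
        ∑ _v : Fin n → E, (1 : ℝ) := fun z =>
      (Finset.abs_sum_le_sum_abs _ _).trans (Finset.sum_le_sum fun v _ =>
        abs_negMulLog_le_one (𝓜.pathProb_nonneg _ z) (𝓜.pathProb_le_one _ z))
    simp only [sum_negMulLog_pathProb_succ]
    rw [integral_add (integrable_finsetSum _ fun e _ => integrable_negMulLog_p μ e)
      (Integrable.of_bound (𝓜.measurable_markovOp hm).aestronglyMeasurable _
        (Eventually.of_forall fun y => 𝓜.abs_sum_p_mul_le fun e => hb _)), hμ.2 _ hm ⟨_, hb⟩, ih]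
    push_cast
    ring

variable [MeasurableSpace E] [DiscreteMeasurableSpace E] {μ : Measure K} {M : Measure (ℤ → E)}

/-- For the partition by the letter at 0, Jensen's inequality for the concave function -t log t
bounds the entropy of the n-words from below by the μ-mean of their entropy given the starting
point, which is exactly linear in n. -/
theorem IsGeneralizedMarkovMeasure.le_ksEntropy (hM : 𝓜.IsGeneralizedMarkovMeasure μ M)
    (hμ : 𝓜.IsInvariant μ) : ((∫ y, ∑ e, Real.negMulLog (𝓜.p e y) ∂μ : ℝ) : EReal) ≤
      ksEntropy M (leftShift : (ℤ → E) → (ℤ → E)) := by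
  have := hμ.1
  let ξ : (ℤ → E) → Fin (Fintype.card E) := fun σ => Fintype.equivFin E (σ 0)
  have hξ : Measurable ξ :=
    (Measurable.of_discrete (f := Fintype.equivFin E)).comp (measurable_pi_apply 0)
  refine le_trans ?_ (le_iSup_of_le _ (le_iSup_of_le ξ (le_iSup_of_le hξ le_rfl)))
  have hH : ∀ n : ℕ, n * ∫ y, ∑ e, Real.negMulLog (𝓜.p e y) ∂μ ≤
      partitionEntropy M (itinerary leftShift ξ n) := fun n => by
    have h1 : partitionEntropy M (itinerary leftShift ξ n) =
        ∑ v : Fin n → E, Real.negMulLog (∫ y, 𝓜.pathProb (List.ofFn v) y ∂μ) := by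
      rw [partitionEntropy, ← (Equiv.piCongrRight fun _ : Fin n => Fintype.equivFin E).sum_comp]
      refine Finset.sum_congr rfl fun v _ => ?_
      rw [← hM.real_wordAt 0 v]
      congr 2
      ext σ
      simp only [Set.mem_preimage, Set.mem_singleton_iff, funext_iff, itinerary, wordAt, ξ,
        leftShift_iterate, shiftBy, Equiv.piCongrRight_apply, Pi.map_apply,
        EmbeddingLike.apply_eq_iff_eq]
    rw [h1, ← integral_sum_negMulLog_pathProb hμ,
      integral_finsetSum _ fun v _ => integrable_negMulLog_pathProb μ _]
    exact Finset.sum_le_sum fun v _ => Real.concaveOn_negMulLog.le_map_integral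
      Real.continuous_negMulLog.continuousOn isClosed_Ici
      (Eventually.of_forall fun y => 𝓜.pathProb_nonneg _ y) (𝓜.integrable_pathProb μ _)
      (integrable_negMulLog_pathProb μ _)
  calc _ = limsup (fun _ : ℕ => ((∫ y, ∑ e, Real.negMulLog (𝓜.p e y) ∂μ : ℝ) : EReal)) atTop :=
        (limsup_const _).symm
    _ ≤ _ := limsup_le_limsup (by
        filter_upwards [eventually_gt_atTop 0] with n hn
        refine EReal.coe_le_coe_iff.2 ?_
        rw [le_div_iff₀' (by exact_mod_cast hn)]
        exact hH n)

end LowerBound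

/-! ## Upper bounds for the entropy of measures on the coding domain -/

section UpperBound

variable {K V E : Type*} [MetricSpace K] [MeasurableSpace K] [Fintype E] {𝓜 : MarkovSystem K V E}
  [MeasurableSpace E] [DiscreteMeasurableSpace E] {x : V → K} {Θ : Measure (ℤ → E)}

open Classical in
/-- The entropy bound given by the transition probabilities `p_e`, perturbed by `s χ` at the
letter `e`. -/
theorem ksEntropy_le_of_perturbation (hΘ : IsInvariantProb leftShift Θ)
    (hp : ∀ e, Continuous (𝓜.p e))
    (hpos : ∃ δ : ℝ, 0 < δ ∧ ∀ e, ∀ y ∈ 𝓜.vset (𝓜.init e), δ ≤ 𝓜.p e y)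
    (hx : ∀ i, x i ∈ 𝓜.vset i) (hY : ∀ᵐ σ ∂Θ, σ ∈ 𝓜.codingDomain x) (e : E)
    {χ : ℕ → (ℤ → E) → ℝ} {χ' : (ℤ → E) → ℝ}
    (hdep : ∀ k : ℕ, DependsOn (χ k) (Set.Icc (-(k : ℤ)) 0)) (hχ : ∀ k σ, |χ k σ| ≤ 1)
    (hlim : ∀ᵐ σ ∂Θ, Tendsto (fun k => χ k σ) atTop (𝓝 (χ' σ))) {s : ℝ} (hs : |s| ≤ 1 / 2) :
    ksEntropy Θ (leftShift : (ℤ → E) → (ℤ → E)) ≤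
      ((-∫ σ, Real.log (𝓜.p (σ 1) (𝓜.codingMap x σ) *
        (1 + s * (if σ 1 = e then χ' σ else 0)) /
          (1 + s * (𝓜.p e (𝓜.codingMap x σ) * χ' σ))) ∂Θ : ℝ) : EReal) := by
  obtain ⟨δ, hδ, hδp⟩ := hpos
  have hsmall : ∀ t : ℝ, |t| ≤ 1 → 1 / 2 ≤ 1 + s * t ∧ 1 + s * t ≤ 3 / 2 := fun t ht => by
    have : |s * t| ≤ 1 / 2 * 1 := by
      rw [abs_mul]
      exact mul_le_mul hs ht (abs_nonneg _) (by norm_num)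
    have := abs_le.1 this
    constructor <;> linarith [this.1, this.2]
  have hite : ∀ (σ τ : ℤ → E) k, |if σ 1 = e then χ k τ else 0| ≤ 1 := fun σ τ k => by
    split_ifs
    · exact hχ k τ
    · simp
  have hpχ : ∀ k σ y, |𝓜.p e y * χ k σ| ≤ 1 := fun k σ y => by
    rw [abs_mul, abs_of_nonneg (𝓜.p_nonneg e y)]
    exact mul_le_one₀ (𝓜.p_le_one e y) (abs_nonneg _) (hχ k σ)
  -- The perturbing factors lie between 1 / 2 and 3 / 2, hence the lower bound δ / 3. Since χ reads
  -- only the past, the denominator is the sum of the numerators over all letters at 1.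
  refine ksEntropy_leftShift_le hΘ (c := δ / 3) (r := fun k σ => 𝓜.p (σ 1) (𝓜.backPoint x σ k) *
    (1 + s * (if σ 1 = e then χ k σ else 0)) / (1 + s * (𝓜.p e (𝓜.backPoint x σ k) * χ k σ)))
    (by positivity) ?_ ?_ ?_ ?_ ?_
  · intro k σ τ h
    have h0 : ∀ j ∈ Set.Icc (-(k : ℤ)) 0, σ j = τ j := fun j hj =>
      h j ⟨hj.1, hj.2.trans zero_le_one⟩
    have h1 : σ 1 = τ 1 := h 1 ⟨by omega, le_rfl⟩
    have h2 : 𝓜.backPoint x σ k = 𝓜.backPoint x τ k := dependsOn_backPoint x k h0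
    simp only [h1, h2, hdep k h0]
  · intro k σ
    exact div_nonneg (mul_nonneg (𝓜.p_nonneg _ _) (by linarith [(hsmall _ (hite σ σ k)).1]))
      (by linarith [(hsmall _ (hpχ k σ (𝓜.backPoint x σ k))).1])
  · intro k σ
    have h0 : ∀ (e' : E), ∀ j ∈ Set.Icc (-(k : ℤ)) 0, Function.update σ 1 e' j = σ j :=
      fun e' j hj => Function.update_of_ne (by have := hj.2; omega) _ _
    have h2 : ∀ e', 𝓜.backPoint x (Function.update σ 1 e') k = 𝓜.backPoint x σ k := fun e' =>
      dependsOn_backPoint x k (h0 e')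
    simp only [h2, fun e' => hdep k (h0 e'), Function.update_self]
    rw [← Finset.sum_div]
    have h3 : ∑ e', 𝓜.p e' (𝓜.backPoint x σ k) * (1 + s * (if e' = e then χ k σ else 0)) =
        1 + s * (𝓜.p e (𝓜.backPoint x σ k) * χ k σ) := by
      simp only [mul_add, mul_one, Finset.sum_add_distrib, 𝓜.p_sum, mul_ite, mul_zero]
      rw [Finset.sum_ite_eq' Finset.univ e, if_pos (Finset.mem_univ e)]
      ring
    rw [h3]
    exact div_self_le_one _
  · filter_upwards [hY] with σ hσ k
    have h1 := hδp _ _ (backPoint_mem hx (mem_limitSet_of_mem_codingDomain hσ).1 k)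
    have h2 := hsmall _ (hite σ σ k)
    have h3 := hsmall _ (hpχ k σ (𝓜.backPoint x σ k))
    calc δ / 3 = δ * (1 / 2) / (3 / 2) := by ring
      _ ≤ _ := div_le_div₀ (mul_nonneg (𝓜.p_nonneg _ _) (by linarith))
          (mul_le_mul h1 h2.1 (by norm_num) (𝓜.p_nonneg _ _)) (by linarith) h3.2
  · filter_upwards [hY, hlim] with σ hσ hl
    have hF := tendsto_backPoint (mem_limitSet_of_mem_codingDomain hσ)
    have hp' : ∀ e', Tendsto (fun k => 𝓜.p e' (𝓜.backPoint x σ k)) atTop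
        (𝓝 (𝓜.p e' (𝓜.codingMap x σ))) := fun e' => ((hp e').tendsto _).comp hF
    have hden := ((hp' e).mul hl).const_mul s |>.const_add 1
    refine Tendsto.div ((hp' _).mul (Tendsto.const_add 1 (Tendsto.const_mul s ?_))) hden ?_
    · split_ifs
      · exact hl
      · exact tendsto_const_nhds
    · have := ge_of_tendsto' hden fun k => (hsmall _ (hpχ k σ (𝓜.backPoint x σ k))).1
      linarith

/-- The case s = 0 of the perturbed bound, in which the choice of the letter is immaterial. -/
theorem ksEntropy_le_of_ae_mem_codingDomain (hΘ : IsInvariantProb leftShift Θ)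
    (hp : ∀ e, Continuous (𝓜.p e))
    (hpos : ∃ δ : ℝ, 0 < δ ∧ ∀ e, ∀ y ∈ 𝓜.vset (𝓜.init e), δ ≤ 𝓜.p e y)
    (hx : ∀ i, x i ∈ 𝓜.vset i) (hY : ∀ᵐ σ ∂Θ, σ ∈ 𝓜.codingDomain x) :
    ksEntropy Θ (leftShift : (ℤ → E) → (ℤ → E)) ≤
      ((-∫ σ, Real.log (𝓜.p (σ 1) (𝓜.codingMap x σ)) ∂Θ : ℝ) : EReal) := by
  have := hΘ.1
  obtain ⟨σ₀⟩ := Θ.nonempty_of_neZero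
  have := ksEntropy_le_of_perturbation hΘ hp hpos hx hY (σ₀ 0) (χ := fun _ _ => 0)
    (χ' := fun _ => 0) (s := 0) (fun k σ τ _ => rfl) (by simp) (by simp) (by norm_num)
  simpa using this

end UpperBound

/-! ## Invariance and continuous functions -/

section Invariance

variable {K V E : Type*} [MeasurableSpace K] [Fintype E] {𝓜 : MarkovSystem K V E}

/-- The law of the Markov process after one step, started with law `ν`. -/
def stepLaw (𝓜 : MarkovSystem K V E) (ν : Measure K) : Measure K :=
  ∑ e, (ν.withDensity fun y => ENNReal.ofReal (𝓜.p e y)).map (𝓜.w e)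

theorem isFiniteMeasure_withDensity_p (ν : Measure K) [IsFiniteMeasure ν] (e : E) :
    IsFiniteMeasure (ν.withDensity fun y => ENNReal.ofReal (𝓜.p e y)) :=
  isFiniteMeasure_withDensity_ofReal
    (Integrable.of_bound (𝓜.p_measurable e).aestronglyMeasurable 1 (Eventually.of_forall fun y => by
      rw [Real.norm_eq_abs, abs_of_nonneg (𝓜.p_nonneg e y)]
      exact 𝓜.p_le_one e y)).2

theorem isFiniteMeasure_stepLaw (ν : Measure K) [IsFiniteMeasure ν] :
    IsFiniteMeasure (𝓜.stepLaw ν) := by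
  have := fun e => isFiniteMeasure_withDensity_p (𝓜 := 𝓜) ν e
  rw [stepLaw]
  infer_instance

theorem integral_stepLaw (ν : Measure K) [IsFiniteMeasure ν] {f : K → ℝ} (hf : Measurable f)
    {C : ℝ} (hC : ∀ y, |f y| ≤ C) : ∫ y, f y ∂(𝓜.stepLaw ν) = ∫ y, 𝓜.markovOp f y ∂ν := by
  have := fun e => isFiniteMeasure_withDensity_p (𝓜 := 𝓜) ν e
  have hb : ∀ (ν' : Measure K) [IsFiniteMeasure ν'] (g : K → ℝ), Measurable g →
      (∀ y, |g y| ≤ C) → Integrable g ν' := fun ν' _ g hg h =>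
    Integrable.of_bound hg.aestronglyMeasurable C (Eventually.of_forall h)
  rw [stepLaw, integral_finsetSum_measure fun e _ => hb _ f hf hC]
  simp only [markovOp]
  rw [integral_finsetSum]
  · refine Finset.sum_congr rfl fun e _ => ?_
    rw [integral_map (𝓜.w_measurable e).aemeasurable hf.aestronglyMeasurable,
      integral_withDensity_eq_integral_toReal_smul (𝓜.p_measurable e).ennreal_ofReal
        (Eventually.of_forall fun y => ENNReal.ofReal_lt_top)]
    simp only [ENNReal.toReal_ofReal (𝓜.p_nonneg e _), smul_eq_mul]
  · intro e _
    refine hb ν _ ((𝓜.p_measurable e).mul (hf.comp (𝓜.w_measurable e))) fun y => ?_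
    rw [abs_mul, abs_of_nonneg (𝓜.p_nonneg e y)]
    exact (mul_le_of_le_one_left (abs_nonneg _) (𝓜.p_le_one e y)).trans (hC _)

variable [MetricSpace K]

/-- Since w_e is known to be continuous only on its vertex set, the product is read as an extension
by zero, p_e vanishing elsewhere. -/
theorem continuous_pathProb (hopen : ∀ i, IsOpen (𝓜.vset i)) (hp : ∀ e, Continuous (𝓜.p e))
    (hw : ∀ e, ContinuousOn (𝓜.w e) (𝓜.vset (𝓜.init e))) (l : List E) :
    Continuous (𝓜.pathProb l) := by
  induction l with
  | nil => exact continuous_const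
  | cons e l ih =>
    have : 𝓜.pathProb (e :: l) =
        (𝓜.vset (𝓜.init e)).indicator fun y => 𝓜.p e y * 𝓜.pathProb l (𝓜.w e y) := by
      funext y
      by_cases h : y ∈ 𝓜.vset (𝓜.init e)
      · rw [Set.indicator_of_mem h, pathProb]
      · rw [Set.indicator_of_notMem h, pathProb, 𝓜.p_zero e y h, zero_mul]
    rw [this]
    exact continuous_indicator_vset hopen ((hp e).continuousOn.mul (ih.comp_continuousOn (hw e)))

/-- A probability measure is invariant if it is preserved by the Markov operator on continuous
functions. -/
theorem isInvariant_of_continuous [BorelSpace K] {ν : Measure K} [IsProbabilityMeasure ν]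
    (h : ∀ f : K → ℝ, Continuous f → (∀ y, |f y| ≤ 1) →
      ∫ y, 𝓜.markovOp f y ∂ν = ∫ y, f y ∂ν) : 𝓜.IsInvariant ν := by
  have := isFiniteMeasure_stepLaw (𝓜 := 𝓜) ν
  have heq : 𝓜.stepLaw ν = ν := by
    refine ext_of_forall_integral_eq_of_IsFiniteMeasure fun f => ?_
    -- Scaling meets the bound 1 of the hypothesis; the added 1 keeps the divisor positive for f =
    -- 0.
    have hc : 0 < ‖f‖ + 1 := by positivity
    have hb : ∀ y, |f y / (‖f‖ + 1)| ≤ 1 := fun y => by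
      rw [abs_div, abs_of_pos hc, div_le_one hc]
      exact (f.norm_coe_le_norm y).trans (by linarith)
    have hcont : Continuous fun y => f y / (‖f‖ + 1) := f.continuous.div_const _
    have := h _ hcont hb
    rw [← integral_stepLaw ν hcont.measurable hb, integral_div, integral_div] at this
    field_simp at this
    exact this
  refine ⟨inferInstance, fun f hf hC => ?_⟩
  obtain ⟨C, hC⟩ := hC
  rw [← integral_stepLaw ν hf hC, heq]

end Invariance

/-! ## Measures of maximal entropy given the energy -/

/-- Together with log (1 + t) ≤ t, this isolates the first order term of the perturbation. -/
theorem sub_two_mul_sq_le_log {t : ℝ} (ht : |t| ≤ 1 / 2) : t - 2 * t ^ 2 ≤ Real.log (1 + t) := by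
  have h1 : 1 / 2 ≤ 1 + t := by linarith [(abs_le.1 ht).1]
  refine le_trans ?_ (Real.one_sub_inv_le_log_of_pos (by linarith))
  have h2 : t ^ 2 * (1 + t)⁻¹ ≤ t ^ 2 * 2 :=
    mul_le_mul_of_nonneg_left (by rw [inv_le_comm₀] <;> linarith) (sq_nonneg t)
  have h3 : 1 - (1 + t)⁻¹ = t - t ^ 2 * (1 + t)⁻¹ := by
    field_simp [show 1 + t ≠ 0 by linarith]
    ring
  rw [h3]
  linarith

theorem measurableSet_eq_letter {E : Type*} [MeasurableSpace E] [DiscreteMeasurableSpace E] (j : ℤ)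
    (e : E) : MeasurableSet {σ : ℤ → E | σ j = e} :=
  (MeasurableSet.singleton e).preimage (measurable_pi_apply (X := fun _ : ℤ => E) j)

section Equilibrium

variable {K V E : Type*} [MetricSpace K] [ProperSpace K] [MeasurableSpace K] [BorelSpace K]
  [Fintype E] {𝓜 : MarkovSystem K V E}
  [MeasurableSpace E] [DiscreteMeasurableSpace E] {x : V → K} {Θ : Measure (ℤ → E)}

open Classical in
/-- If the entropy is as large as the energy allows, then the letter at `1` has conditional
probabilities `p_e ∘ F` given the past. -/
theorem integral_ite_letter_eq (hΘ : IsInvariantProb leftShift Θ)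
    (hopen : ∀ i, IsOpen (𝓜.vset i)) (hp : ∀ e, Continuous (𝓜.p e))
    (hpos : ∃ δ : ℝ, 0 < δ ∧ ∀ e, ∀ y ∈ 𝓜.vset (𝓜.init e), δ ≤ 𝓜.p e y)
    (hx : ∀ i, x i ∈ 𝓜.vset i) (hY : ∀ᵐ σ ∂Θ, σ ∈ 𝓜.codingDomain x)
    (hent : ((-∫ σ, Real.log (𝓜.p (σ 1) (𝓜.codingMap x σ)) ∂Θ : ℝ) : EReal) ≤
      ksEntropy Θ (leftShift : (ℤ → E) → (ℤ → E))) (e : E) {N : ℕ} {ψ : (ℤ → E) → ℝ}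
    (hψ : DependsOn ψ (Set.Icc (-(N : ℤ)) 0)) (hψ1 : ∀ σ, |ψ σ| ≤ 1) {g : K → ℝ}
    (hg : Continuous g) (hg1 : ∀ y, |g y| ≤ 1) :
    ∫ σ, (if σ 1 = e then ψ σ * g (𝓜.codingMap x σ) else 0) ∂Θ =
      ∫ σ, 𝓜.p e (𝓜.codingMap x σ) * (ψ σ * g (𝓜.codingMap x σ)) ∂Θ := by
  have := hΘ.1
  have hFm := measurable_codingMap (𝓜 := 𝓜) x
  have hψg : ∀ σ y, |ψ σ * g y| ≤ 1 := fun σ y => by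
    rw [abs_mul]
    exact mul_le_one₀ (hψ1 σ) (abs_nonneg _) (hg1 y)
  let χ' : (ℤ → E) → ℝ := fun σ => ψ σ * g (𝓜.codingMap x σ)
  let A : (ℤ → E) → ℝ := fun σ => if σ 1 = e then χ' σ else 0
  let B : (ℤ → E) → ℝ := fun σ => 𝓜.p e (𝓜.codingMap x σ) * χ' σ
  have hχm : Measurable χ' := hψ.measurable_of_Icc.mul (hg.measurable.comp hFm)
  have hAm : Measurable A := Measurable.ite
    (measurableSet_eq_letter 1 e) hχm measurable_const
  have hBm : Measurable B := ((𝓜.p_measurable e).comp hFm).mul hχm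
  have hA1 : ∀ σ, |A σ| ≤ 1 := fun σ => by
    simp only [A]
    split_ifs
    · exact hψg _ _
    · simp
  have hB1 : ∀ σ, |B σ| ≤ 1 := fun σ => by
    simp only [B]
    rw [abs_mul, abs_of_nonneg (𝓜.p_nonneg e _)]
    exact mul_le_one₀ (𝓜.p_le_one e _) (abs_nonneg _) (hψg _ _)
  have hint : ∀ f : (ℤ → E) → ℝ, Measurable f → (∀ σ, |f σ| ≤ 1) → Integrable f Θ :=
    fun f hf h => Integrable.of_bound hf.aestronglyMeasurable 1 (Eventually.of_forall h)
  have hlogint : ∀ (f : (ℤ → E) → ℝ) (s : ℝ), Measurable f → (∀ σ, |f σ| ≤ 1) → |s| ≤ 1 / 2 →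
      Integrable (fun σ => Real.log (1 + s * f σ)) Θ ∧ ∀ σ, |s * f σ| ≤ 1 / 2 :=
    fun f s hf h hs => by
    have hsf : ∀ σ, |s * f σ| ≤ 1 / 2 := fun σ => by
      rw [abs_mul]
      exact (mul_le_mul hs (h σ) (abs_nonneg _) (by norm_num)).trans (by norm_num)
    refine ⟨hint _ (Real.measurable_log.comp ((hf.const_mul s).const_add 1)) fun σ => ?_, hsf⟩
    have h1 := abs_le.1 (hsf σ)
    have h2 := sub_two_mul_sq_le_log (hsf σ)
    have h3 := Real.log_le_sub_one_of_pos (show 0 < 1 + s * f σ by linarith [h1.1])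
    have h4 : (s * f σ) ^ 2 ≤ (1 / 2) ^ 2 := sq_le_sq' (by linarith [h1.1]) h1.2
    exact abs_le.2 ⟨by linarith [h1.1], by linarith [h1.2]⟩
  have hlogp := (energyIntegral_energy hopen hx hpos hY).1
  -- The perturbed entropy bound cannot be below the unperturbed one, so ∫ log (1 + s A) ≤ ∫ log (1
  -- + s B); both sides are then replaced by their first order bounds.
  have hineq : ∀ s : ℝ, |s| ≤ 1 / 2 →
      s * (∫ σ, A σ ∂Θ) - 2 * s ^ 2 ≤ s * ∫ σ, B σ ∂Θ := fun s hs => by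
    obtain ⟨hAi, hAs⟩ := hlogint A s hAm hA1 hs
    obtain ⟨hBi, hBs⟩ := hlogint B s hBm hB1 hs
    -- At stage k only the letters at -k, …, 0 may be read, while ψ reads down to -N; the value 0
    -- for k < N does not affect the limit.
    have hbound := hent.trans (ksEntropy_le_of_perturbation hΘ hp hpos hx hY e
      (χ := fun k σ => if N ≤ k then ψ σ * g (𝓜.backPoint x σ k) else 0) (χ' := χ')
      (fun k σ τ h => by
        by_cases hk : N ≤ k
        · simp only [if_pos hk]
          rw [hψ fun j hj => h j ⟨by have := hj.1; omega, hj.2⟩,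
            show 𝓜.backPoint x σ k = 𝓜.backPoint x τ k from dependsOn_backPoint x k h]
        · simp only [if_neg hk])
      (fun k σ => by
        split_ifs
        · exact hψg _ _
        · simp)
      (by
        filter_upwards [hY] with σ hσ
        have hF := tendsto_backPoint (mem_limitSet_of_mem_codingDomain hσ)
        refine (((hg.tendsto _).comp hF).const_mul (ψ σ)).congr' ?_
        filter_upwards [eventually_ge_atTop N] with k hk
        simp only [if_pos hk, Function.comp_apply]) hs)
    have hbound' := neg_le_neg_iff.1 (EReal.coe_le_coe_iff.1 hbound)
    have hlog : ∀ᵐ σ ∂Θ, Real.log (𝓜.p (σ 1) (𝓜.codingMap x σ) *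
        (1 + s * (if σ 1 = e then χ' σ else 0)) / (1 + s * (𝓜.p e (𝓜.codingMap x σ) * χ' σ))) =
        Real.log (𝓜.p (σ 1) (𝓜.codingMap x σ)) +
          (Real.log (1 + s * A σ) - Real.log (1 + s * B σ)) := by
      obtain ⟨δ, hδ, hδp⟩ := hpos
      filter_upwards [hY] with σ hσ
      have h1 := hδ.trans_le (hδp _ _ (codingMap_mem hopen hx hσ))
      have h2 : 0 < 1 + s * A σ := by linarith [(abs_le.1 (hAs σ)).1]
      have h3 : 0 < 1 + s * B σ := by linarith [(abs_le.1 (hBs σ)).1]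
      rw [Real.log_div (mul_pos h1 h2).ne' h3.ne', Real.log_mul h1.ne' h2.ne']
      ring
    have hadd := integral_add hlogp (hAi.sub hBi)
    simp only [Pi.sub_apply] at hadd
    rw [integral_congr_ae hlog, hadd, integral_sub hAi hBi] at hbound'
    have hA' : s * (∫ σ, A σ ∂Θ) - 2 * s ^ 2 ≤ ∫ σ, Real.log (1 + s * A σ) ∂Θ := by
      rw [← integral_const_mul, show 2 * s ^ 2 = ∫ _σ : ℤ → E, 2 * s ^ 2 ∂Θ by simp,
        ← integral_sub ((hint A hAm hA1).const_mul s) (integrable_const _)]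
      refine integral_mono (((hint A hAm hA1).const_mul s).sub (integrable_const _)) hAi fun σ => ?_
      have h1 := sub_two_mul_sq_le_log (hAs σ)
      have h2 : (s * A σ) ^ 2 ≤ s ^ 2 := by
        rw [mul_pow]
        exact mul_le_of_le_one_right (sq_nonneg s) ((sq_le_one_iff_abs_le_one _).2 (hA1 σ))
      simp only
      linarith
    have hB' : ∫ σ, Real.log (1 + s * B σ) ∂Θ ≤ s * ∫ σ, B σ ∂Θ := by
      rw [← integral_const_mul]
      refine integral_mono hBi ((hint B hBm hB1).const_mul s) fun σ => ?_
      have := Real.log_le_sub_one_of_pos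
        (show 0 < 1 + s * B σ by linarith [(abs_le.1 (hBs σ)).1])
      simp only
      linarith
    linarith
  have hI : ∀ f : (ℤ → E) → ℝ, (∀ σ, |f σ| ≤ 1) → |∫ σ, f σ ∂Θ| ≤ 1 := fun f hf => by
    have := norm_integral_le_of_norm_le_const (μ := Θ) (C := 1)
      (Eventually.of_forall fun σ => (Real.norm_eq_abs (f σ)).trans_le (hf σ))
    simpa using this
  have hA2 := abs_le.1 (hI A hA1)
  have hB2 := abs_le.1 (hI B hB1)
  set D := (∫ σ, A σ ∂Θ) - ∫ σ, B σ ∂Θ with hD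
  -- As |D| ≤ 2, the value s = D / 4 is allowed, and s D ≤ 2 s² becomes D² / 4 ≤ D² / 8.
  have hfin := hineq (D / 4) (abs_le.2 ⟨by linarith [hA2.1, hB2.2], by linarith [hA2.2, hB2.1]⟩)
  have hD0 : D = 0 := by
    have : D * D ≤ 0 := by
      have h1 : D / 4 * D ≤ 2 * (D / 4) ^ 2 := by
        rw [hD] at hfin ⊢
        linarith
      linarith
    exact mul_self_eq_zero.1 (le_antisymm this (mul_self_nonneg D))
  exact sub_eq_zero.1 hD0

open Classical in
-- Where σ 1 = e, the point F(S σ) is w_e(F σ). The function f ∘ w_e, cut off outside the vertex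
-- set, is continuous, so the conditional probabilities apply to it.
theorem integral_ite_letter_comp_leftShift (hΘ : IsInvariantProb leftShift Θ)
    (hopen : ∀ i, IsOpen (𝓜.vset i)) (hp : ∀ e, Continuous (𝓜.p e))
    (hw : ∀ e, ContinuousOn (𝓜.w e) (𝓜.vset (𝓜.init e)))
    (hpos : ∃ δ : ℝ, 0 < δ ∧ ∀ e, ∀ y ∈ 𝓜.vset (𝓜.init e), δ ≤ 𝓜.p e y)
    (hx : ∀ i, x i ∈ 𝓜.vset i) (hY : ∀ᵐ σ ∂Θ, σ ∈ 𝓜.codingDomain x)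
    (hent : ((-∫ σ, Real.log (𝓜.p (σ 1) (𝓜.codingMap x σ)) ∂Θ : ℝ) : EReal) ≤
      ksEntropy Θ (leftShift : (ℤ → E) → (ℤ → E))) (e : E) {N : ℕ} {ψ : (ℤ → E) → ℝ}
    (hψ : DependsOn ψ (Set.Icc (-(N : ℤ)) 0)) (hψ1 : ∀ σ, |ψ σ| ≤ 1) {f : K → ℝ}
    (hf : Continuous f) (hf1 : ∀ y, |f y| ≤ 1) :
    ∫ σ, (if σ 1 = e then ψ σ * f (𝓜.codingMap x (leftShift σ)) else 0) ∂Θ =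
      ∫ σ, ψ σ * (𝓜.p e (𝓜.codingMap x σ) * f (𝓜.w e (𝓜.codingMap x σ))) ∂Θ := by
  let g : K → ℝ := (𝓜.vset (𝓜.init e)).indicator fun y => f (𝓜.w e y)
  have hg : Continuous g := continuous_indicator_vset hopen (hf.comp_continuousOn (hw e))
  have hg1 : ∀ y, |g y| ≤ 1 := fun y => by
    simp only [g, Set.indicator]
    split_ifs
    · exact hf1 _
    · simp
  have h1 : ∫ σ, (if σ 1 = e then ψ σ * f (𝓜.codingMap x (leftShift σ)) else 0) ∂Θ =
      ∫ σ, (if σ 1 = e then ψ σ * g (𝓜.codingMap x σ) else 0) ∂Θ := by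
    refine integral_congr_ae ?_
    filter_upwards [hY] with σ hσ
    by_cases h : σ 1 = e
    · simp only [if_pos h]
      rw [codingMap_leftShift hopen hw hx hσ]
      simp only [g]
      rw [Set.indicator_of_mem (h ▸ codingMap_mem hopen hx hσ), h]
    · simp only [if_neg h]
  rw [h1, integral_ite_letter_eq hΘ hopen hp hpos hx hY hent e hψ hψ1 hg hg1]
  refine integral_congr_ae (Eventually.of_forall fun σ => ?_)
  simp only [g]
  by_cases h : 𝓜.codingMap x σ ∈ 𝓜.vset (𝓜.init e)
  · rw [Set.indicator_of_mem h]
    ring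
  · rw [𝓜.p_zero e _ h]
    ring

/-- Summing the one-letter identity with ψ = 1 over all letters gives ∫ U f ∘ F = ∫ f ∘ F ∘ S, and
the shift disappears by invariance of Θ. -/
theorem isInvariant_map_codingMap (hΘ : IsInvariantProb leftShift Θ)
    (hopen : ∀ i, IsOpen (𝓜.vset i)) (hp : ∀ e, Continuous (𝓜.p e))
    (hw : ∀ e, ContinuousOn (𝓜.w e) (𝓜.vset (𝓜.init e)))
    (hpos : ∃ δ : ℝ, 0 < δ ∧ ∀ e, ∀ y ∈ 𝓜.vset (𝓜.init e), δ ≤ 𝓜.p e y)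
    (hx : ∀ i, x i ∈ 𝓜.vset i) (hY : ∀ᵐ σ ∂Θ, σ ∈ 𝓜.codingDomain x)
    (hent : ((-∫ σ, Real.log (𝓜.p (σ 1) (𝓜.codingMap x σ)) ∂Θ : ℝ) : EReal) ≤
      ksEntropy Θ (leftShift : (ℤ → E) → (ℤ → E))) : 𝓜.IsInvariant (Θ.map (𝓜.codingMap x)) := by
  classical
  have := hΘ.1
  have hFm := measurable_codingMap (𝓜 := 𝓜) x
  have := Measure.isProbabilityMeasure_map (μ := Θ) hFm.aemeasurable
  refine isInvariant_of_continuous fun f hf hf1 => ?_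
  rw [integral_map hFm.aemeasurable (𝓜.measurable_markovOp hf.measurable).aestronglyMeasurable,
    integral_map hFm.aemeasurable hf.measurable.aestronglyMeasurable]
  have hinv : ∫ σ, f (𝓜.codingMap x (leftShift σ)) ∂Θ = ∫ σ, f (𝓜.codingMap x σ) ∂Θ :=
    hΘ.2.integral_comp' (f := shiftEquiv 1) fun σ => f (𝓜.codingMap x σ)
  rw [← hinv]
  have hi1 : ∀ e, Integrable (fun σ : ℤ → E =>
      if σ 1 = e then 1 * f (𝓜.codingMap x (leftShift σ)) else 0) Θ := fun e => by
    refine Integrable.of_bound (Measurable.aestronglyMeasurable (Measurable.ite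
      (measurableSet_eq_letter 1 e)
      ((hf.measurable.comp (hFm.comp hΘ.2.measurable)).const_mul 1) measurable_const)) 1
      (Eventually.of_forall fun σ => ?_)
    rw [Real.norm_eq_abs, one_mul]
    split_ifs
    · exact hf1 _
    · simp
  have hi2 : ∀ e, Integrable (fun σ : ℤ → E =>
      𝓜.p e (𝓜.codingMap x σ) * f (𝓜.w e (𝓜.codingMap x σ))) Θ := fun e => by
    refine Integrable.of_bound (((𝓜.p_measurable e).comp hFm).mul
      (hf.measurable.comp ((𝓜.w_measurable e).comp hFm))).aestronglyMeasurable 1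
      (Eventually.of_forall fun σ => ?_)
    rw [Real.norm_eq_abs, abs_mul, abs_of_nonneg (𝓜.p_nonneg e _)]
    exact mul_le_one₀ (𝓜.p_le_one e _) (abs_nonneg _) (hf1 _)
  calc ∫ σ, 𝓜.markovOp f (𝓜.codingMap x σ) ∂Θ
      = ∑ e, ∫ σ, 𝓜.p e (𝓜.codingMap x σ) * f (𝓜.w e (𝓜.codingMap x σ)) ∂Θ := by
        rw [← integral_finsetSum _ fun e _ => hi2 e]
        rfl
    _ = ∑ e, ∫ σ, (if σ 1 = e then 1 * f (𝓜.codingMap x (leftShift σ)) else 0) ∂Θ := by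
        refine Finset.sum_congr rfl fun e _ => ?_
        rw [integral_ite_letter_comp_leftShift hΘ hopen hp hw hpos hx hY hent e (N := 0)
          (ψ := fun _ => 1) (fun _ _ _ => rfl) (by simp) hf hf1]
        simp only [one_mul]
    _ = _ := by
        rw [← integral_finsetSum _ fun e _ => hi1 e]
        simp

open Classical in
-- Induction on the word, with a general past weight ψ: after a shift the first letter lies at 0 and
-- is absorbed into the weight, and the remaining word again begins at 1. The one-letter identity
-- with f = `pathProb l` then brings the first letter back.
theorem integral_ite_codeCylinder (hΘ : IsInvariantProb leftShift Θ)
    (hopen : ∀ i, IsOpen (𝓜.vset i)) (hp : ∀ e, Continuous (𝓜.p e))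
    (hw : ∀ e, ContinuousOn (𝓜.w e) (𝓜.vset (𝓜.init e)))
    (hpos : ∃ δ : ℝ, 0 < δ ∧ ∀ e, ∀ y ∈ 𝓜.vset (𝓜.init e), δ ≤ 𝓜.p e y)
    (hx : ∀ i, x i ∈ 𝓜.vset i) (hY : ∀ᵐ σ ∂Θ, σ ∈ 𝓜.codingDomain x)
    (hent : ((-∫ σ, Real.log (𝓜.p (σ 1) (𝓜.codingMap x σ)) ∂Θ : ℝ) : EReal) ≤
      ksEntropy Θ (leftShift : (ℤ → E) → (ℤ → E))) (l : List E) {N : ℕ} {ψ : (ℤ → E) → ℝ}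
    (hψ : DependsOn ψ (Set.Icc (-(N : ℤ)) 0)) (hψ1 : ∀ σ, |ψ σ| ≤ 1) :
    ∫ σ, (if σ ∈ codeCylinder 1 l then ψ σ else 0) ∂Θ =
      ∫ σ, ψ σ * 𝓜.pathProb l (𝓜.codingMap x σ) ∂Θ := by
  induction l generalizing N ψ with
  | nil => simp [codeCylinder, pathProb]
  | cons e l ih =>
    let ψ' : (ℤ → E) → ℝ := fun τ => if τ 0 = e then ψ (shiftBy (-1) τ) else 0
    have hψ' : DependsOn ψ' (Set.Icc (-((N + 1 : ℕ) : ℤ)) 0) := by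
      intro σ τ h
      simp only [ψ']
      rw [h 0 ⟨by omega, le_rfl⟩, hψ (x := shiftBy (-1) σ) (y := shiftBy (-1) τ) fun j hj =>
        h (j + -1) ⟨by have := hj.1; push_cast; omega, by have := hj.2; omega⟩]
    have hψ'1 : ∀ τ, |ψ' τ| ≤ 1 := fun τ => by
      simp only [ψ']
      split_ifs
      · exact hψ1 _
      · simp
    have hψ's : ∀ σ, ψ' (leftShift σ) = if σ 1 = e then ψ σ else 0 := fun σ => by
      simp only [ψ', leftShift, shiftBy_shiftBy, neg_add_cancel, shiftBy_zero]
      simp [shiftBy]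
    have hcyl : ∀ σ : ℤ → E, σ ∈ codeCylinder 1 (e :: l) ↔
        σ 1 = e ∧ leftShift σ ∈ codeCylinder 1 l := fun σ => by
      simp only [codeCylinder, Set.mem_ofPred_eq, leftShift, shiftBy]
      constructor
      · intro h
        refine ⟨h 0 (by simp), fun k hk => ?_⟩
        have := h (k + 1) (by simpa using hk)
        rw [List.getElem_cons_succ] at this
        rw [← this]
        push_cast
        ring_nf
      · rintro ⟨h0, h⟩ k hk
        cases k with
        | zero => simpa using h0
        | succ k =>
          rw [List.getElem_cons_succ, ← h k (by simpa using hk)]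
          push_cast
          ring_nf
    have hinv : ∀ f : (ℤ → E) → ℝ, ∫ σ, f (leftShift σ) ∂Θ = ∫ σ, f σ ∂Θ := fun f =>
      hΘ.2.integral_comp' (f := shiftEquiv 1) f
    calc ∫ σ, (if σ ∈ codeCylinder 1 (e :: l) then ψ σ else 0) ∂Θ
        = ∫ σ, (if leftShift σ ∈ codeCylinder 1 l then ψ' (leftShift σ) else 0) ∂Θ := by
          congr 1
          funext σ
          simp only [hcyl, hψ's]
          by_cases h1 : σ 1 = e <;> by_cases h2 : leftShift σ ∈ codeCylinder 1 l <;> simp [h1, h2]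
      _ = ∫ σ, ψ' (leftShift σ) * 𝓜.pathProb l (𝓜.codingMap x (leftShift σ)) ∂Θ := by
          rw [hinv fun σ => if σ ∈ codeCylinder 1 l then ψ' σ else 0, ih hψ' hψ'1,
            hinv fun σ => ψ' σ * 𝓜.pathProb l (𝓜.codingMap x σ)]
      _ = ∫ σ, (if σ 1 = e then ψ σ * 𝓜.pathProb l (𝓜.codingMap x (leftShift σ)) else 0) ∂Θ := by
          simp only [hψ's, ite_mul, zero_mul]
      _ = _ := by
          rw [integral_ite_letter_comp_leftShift hΘ hopen hp hw hpos hx hY hent e hψ hψ1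
            (continuous_pathProb hopen hp hw l) fun y => by
              rw [abs_of_nonneg (𝓜.pathProb_nonneg l y)]
              exact 𝓜.pathProb_le_one l y]
          rfl

/-- A measure whose entropy is as large as the energy allows is a generalized Markov measure. -/
theorem real_wordAt_eq_of_le_ksEntropy (hΘ : IsInvariantProb leftShift Θ)
    (hopen : ∀ i, IsOpen (𝓜.vset i)) (hp : ∀ e, Continuous (𝓜.p e))
    (hw : ∀ e, ContinuousOn (𝓜.w e) (𝓜.vset (𝓜.init e)))
    (hpos : ∃ δ : ℝ, 0 < δ ∧ ∀ e, ∀ y ∈ 𝓜.vset (𝓜.init e), δ ≤ 𝓜.p e y)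
    (hx : ∀ i, x i ∈ 𝓜.vset i) (hY : ∀ᵐ σ ∂Θ, σ ∈ 𝓜.codingDomain x)
    (hent : ((-∫ σ, Real.log (𝓜.p (σ 1) (𝓜.codingMap x σ)) ∂Θ : ℝ) : EReal) ≤
      ksEntropy Θ (leftShift : (ℤ → E) → (ℤ → E))) (m : ℤ) {n : ℕ} (v : Fin n → E) :
    Θ.real (wordAt m n ⁻¹' {v}) =
      ∫ y, 𝓜.pathProb (List.ofFn v) y ∂(Θ.map (𝓜.codingMap x)) := by
  classical
  have := hΘ.1
  have hms : ∀ m : ℤ, MeasurableSet (wordAt m n ⁻¹' {v}) := fun m =>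
    measurable_wordAt m n (MeasurableSet.singleton v)
  have h1 : Θ.real (wordAt m n ⁻¹' {v}) = Θ.real (wordAt 1 n ⁻¹' {v}) := by
    rw [← (measurePreserving_shiftBy hΘ.2 (m - 1)).measureReal_preimage (hms 1).nullMeasurableSet]
    congr 1
    ext σ
    simp only [Set.mem_preimage, Set.mem_singleton_iff, funext_iff, wordAt, shiftBy]
    refine forall_congr' fun j => ?_
    rw [show (1 : ℤ) + (j : ℕ) + (m - 1) = m + (j : ℕ) by ring]
  have h2 := integral_ite_codeCylinder hΘ hopen hp hw hpos hx hY hent (List.ofFn v) (N := 0)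
    (ψ := fun _ => 1) (fun _ _ _ => rfl) (by simp)
  rw [integral_map (measurable_codingMap x).aemeasurable
    (𝓜.pathProb_measurable _).aestronglyMeasurable, h1]
  simp only [one_mul] at h2
  rw [← h2, codeCylinder_ofFn, ← integral_indicator_one (hms 1)]
  rfl

end Equilibrium

/-! ### The integral of the logarithm and the upper bound for the pressure -/

section Main

variable {K V E : Type*} [MeasurableSpace K] [Fintype E] {𝓜 : MarkovSystem K V E}

theorem abs_log_p_le {δ : ℝ} (hδ : 0 < δ) (hδp : ∀ e, ∀ y ∈ 𝓜.vset (𝓜.init e), δ ≤ 𝓜.p e y) (e : E)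
    (y : K) : |Real.log (𝓜.p e y)| ≤ |Real.log δ| := by
  by_cases h : y ∈ 𝓜.vset (𝓜.init e)
  · have h1 := hδp e y h
    have h2 := 𝓜.p_le_one e y
    rw [abs_of_nonpos (Real.log_nonpos (𝓜.p_nonneg e y) h2),
      abs_of_nonpos (Real.log_nonpos hδ.le (h1.trans h2))]
    exact neg_le_neg (Real.log_le_log hδ h1)
  -- Off the vertex set the convention `Real.log 0 = 0` applies.
  · rw [𝓜.p_zero e y h]
    simp

theorem integral_sum_negMulLog_p (μ : Measure K) [IsFiniteMeasure μ] :
    ∫ y, ∑ e, Real.negMulLog (𝓜.p e y) ∂μ =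
      -∑ e, ∫ y in 𝓜.vset (𝓜.init e), 𝓜.p e y * Real.log (𝓜.p e y) ∂μ := by
  rw [integral_finsetSum _ fun e _ => integrable_negMulLog_p μ e, ← Finset.sum_neg_distrib]
  refine Finset.sum_congr rfl fun e _ => ?_
  rw [setIntegral_eq_integral_of_forall_compl_eq_zero fun y hy => by rw [𝓜.p_zero e y hy, zero_mul],
    ← integral_neg]
  simp only [Real.negMulLog, neg_mul]

theorem uniformContinuousOn_log_p [MetricSpace K]
    (hcont : ∀ e, UniformContinuousOn (𝓜.p e) (𝓜.vset (𝓜.init e)))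
    (hpos : ∃ δ : ℝ, 0 < δ ∧ ∀ e, ∀ y ∈ 𝓜.vset (𝓜.init e), δ ≤ 𝓜.p e y) (e : E) :
    UniformContinuousOn (fun y => Real.log (𝓜.p e y)) (𝓜.vset (𝓜.init e)) := by
  obtain ⟨δ, hδ, hδp⟩ := hpos
  have hlog : UniformContinuousOn Real.log (Set.Icc δ 1) :=
    isCompact_Icc.uniformContinuousOn_of_continuous
      (Real.continuousOn_log.mono fun t ht => (hδ.trans_le ht.1).ne')
  exact hlog.comp (hcont e) fun y hy => ⟨hδp e y hy, 𝓜.p_le_one e y⟩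

variable [MetricSpace K] [ProperSpace K] [BorelSpace K] [MeasurableSpace E] [DiscreteMeasurableSpace E] {x : V → K}

/-- Energy -∞ makes the sum -∞ whatever the entropy is; otherwise the measure lives on Y and the
entropy bound cancels the energy. -/
theorem ksEntropy_add_energyIntegral_le (hopen : ∀ i, IsOpen (𝓜.vset i))
    (hp : ∀ e, Continuous (𝓜.p e))
    (hpos : ∃ δ : ℝ, 0 < δ ∧ ∀ e, ∀ y ∈ 𝓜.vset (𝓜.init e), δ ≤ 𝓜.p e y)
    (hx : ∀ i, x i ∈ 𝓜.vset i) {Θ : Measure (ℤ → E)} (hΘ : IsInvariantProb leftShift Θ) :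
    ksEntropy Θ leftShift + energyIntegral Θ (𝓜.energy x) ≤ 0 := by
  have := hΘ.1
  by_cases h : energyIntegral Θ (𝓜.energy x) = ⊥
  · rw [h, EReal.add_bot]
    exact bot_le
  · have hY := ae_mem_codingDomain h
    rw [(energyIntegral_energy hopen hx hpos hY).2]
    refine (add_le_add_left (ksEntropy_le_of_ae_mem_codingDomain hΘ hp hpos hx hY) _).trans_eq ?_
    rw [← EReal.coe_add, neg_add_cancel, EReal.coe_zero]

end Main

end MarkovSystem

end

theorem theorem2 {K V E : Type*} [MetricSpace K] [ProperSpace K] [MeasurableSpace K] [BorelSpace K]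
    [Finite V] [Fintype E] [MeasurableSpace E] [DiscreteMeasurableSpace E]
    (𝓜 : MarkovSystem K V E)
    (hcontr : 𝓜.IsContractive)
    (hopen : ∀ i, IsOpen (𝓜.vset i))
    (hcont : ∀ e, UniformContinuousOn (𝓜.p e) (𝓜.vset (𝓜.init e)))
    (hpos : ∃ δ : ℝ, 0 < δ ∧ ∀ e, ∀ y ∈ 𝓜.vset (𝓜.init e), δ ≤ 𝓜.p e y)
    (x : V → K) (hx : ∀ i, x i ∈ 𝓜.vset i)
    (μ : Measure K) (hμ : 𝓜.IsInvariant μ)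
    (huniq : ∀ ν : Measure K, 𝓜.IsInvariant ν → ν = μ)
    (hY : 𝓜.generalizedMarkovMeasure hμ (𝓜.codingDomain x) = 1) :
    -- `u` is an energy function and `M` is its unique equilibrium state
    (IsEnergyFunction (𝓜.energy x) ∧
      IsEquilibriumState leftShift (𝓜.energy x) (𝓜.generalizedMarkovMeasure hμ) ∧
      ∀ Λ : Measure (ℤ → E), IsEquilibriumState leftShift (𝓜.energy x) Λ →
        Λ = 𝓜.generalizedMarkovMeasure hμ) ∧
    -- `F(M) = μ`
    (𝓜.generalizedMarkovMeasure hμ).map (𝓜.codingMap x) = μ ∧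
    -- the entropy formula
    ksEntropy (𝓜.generalizedMarkovMeasure hμ) (leftShift : (ℤ → E) → (ℤ → E)) =
      ((-∑ e, ∫ y in 𝓜.vset (𝓜.init e), 𝓜.p e y * Real.log (𝓜.p e y) ∂μ : ℝ) : EReal) := by
  have hμp := hμ.1
  have hM := 𝓜.generalizedMarkovMeasure_spec hμ
  set M := 𝓜.generalizedMarkovMeasure hμ
  have hMp := hM.isProbabilityMeasure
  have hMinv := hM.isInvariantProb
  have hYae : ∀ᵐ σ ∂M, σ ∈ 𝓜.codingDomain x :=
    (mem_ae_iff_prob_eq_one (MarkovSystem.measurableSet_codingDomain x)).2 hY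
  have hp := MarkovSystem.continuous_p hopen hcont
  have hw := MarkovSystem.continuousOn_w hcontr hpos
  have henergy := MarkovSystem.energyIntegral_energy hopen hx hpos hYae
  have hlogp : ∫ σ, Real.log (𝓜.p (σ 1) (𝓜.codingMap x σ)) ∂M =
      -∫ y, ∑ e, Real.negMulLog (𝓜.p e y) ∂μ := by
    obtain ⟨δ, hδ, hδp⟩ := id hpos
    rw [hM.integral_coding (φ := fun e y => Real.log (𝓜.p e y)) hμ hcontr hopen hx hYae
      (fun e => Real.measurable_log.comp (𝓜.p_measurable e)) (MarkovSystem.abs_log_p_le hδ hδp)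
      (MarkovSystem.uniformContinuousOn_log_p hcont hpos), ← integral_neg]
    simp only [Real.negMulLog, neg_mul, Finset.sum_neg_distrib, neg_neg]
  have hent : ksEntropy M leftShift =
      ((∫ y, ∑ e, Real.negMulLog (𝓜.p e y) ∂μ : ℝ) : EReal) := by
    refine le_antisymm ?_ (hM.le_ksEntropy hμ)
    have := MarkovSystem.ksEntropy_le_of_ae_mem_codingDomain hMinv hp hpos hx hYae
    rwa [hlogp, neg_neg] at this
  have hM0 : ksEntropy M leftShift + energyIntegral M (𝓜.energy x) = 0 := by
    rw [hent, henergy.2, hlogp, ← EReal.coe_add, add_neg_cancel, EReal.coe_zero]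
  have hpress : pressure leftShift (𝓜.energy x) = 0 :=
    le_antisymm (iSup₂_le fun Θ hΘ =>
      MarkovSystem.ksEntropy_add_energyIntegral_le hopen hp hpos hx hΘ)
      (hM0.symm.le.trans (le_iSup₂ (f := fun Θ (_ : IsInvariantProb leftShift Θ) =>
        ksEntropy Θ leftShift + energyIntegral Θ (𝓜.energy x)) M hMinv))
  refine ⟨⟨MarkovSystem.isEnergyFunction_energy x, ⟨hMinv, hM0.trans hpress.symm⟩, ?_⟩,
    hM.map_codingMap hμ hcontr hopen hx hYae, ?_⟩
  · rintro Λ ⟨hΛ, hΛeq⟩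
    have hΛp := hΛ.1
    rw [hpress] at hΛeq
    have hne : energyIntegral Λ (𝓜.energy x) ≠ ⊥ := fun h => by
      rw [h, EReal.add_bot] at hΛeq
      exact EReal.bot_ne_zero hΛeq
    have hYΛ := MarkovSystem.ae_mem_codingDomain hne
    rw [(MarkovSystem.energyIntegral_energy hopen hx hpos hYΛ).2] at hΛeq
    -- Entropy plus a finite energy is zero, so the Gibbs bound is attained by Λ.
    have hle : ((-∫ σ, Real.log (𝓜.p (σ 1) (𝓜.codingMap x σ)) ∂Λ : ℝ) : EReal) ≤
        ksEntropy Λ leftShift := by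
      by_contra! hlt
      have := EReal.add_lt_add_right_coe hlt
        (∫ σ, Real.log (𝓜.p (σ 1) (𝓜.codingMap x σ)) ∂Λ)
      rw [hΛeq, ← EReal.coe_add, neg_add_cancel, EReal.coe_zero] at this
      exact lt_irrefl _ this
    -- Here the uniqueness of μ enters: Λ is a generalized Markov measure for F(Λ), which must be μ.
    have hν := huniq _ (MarkovSystem.isInvariant_map_codingMap hΛ hopen hp hw hpos hx hYΛ hle)
    refine hM.eq_of_wordAt fun m n v => ?_
    rw [MarkovSystem.real_wordAt_eq_of_le_ksEntropy hΛ hopen hp hw hpos hx hYΛ hle m v, hν]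
  · rw [hent, MarkovSystem.integral_sum_negMulLog_p]
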